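/- Write $N(0,I_k)$ for the standard Gaussian distribution on $\mathbb R^k$, and let $\|\cdot\|_q$ and $\langle f,g\rangle=\mathbb E_{x\sim N(0,I_k)}[f(x)g(x)]$ be the $L^q$-norms and the inner product with respect to it. Let $h_j$ be the probabilists' Hermite polynomials; for $J\in\mathbb N^k$ put $|J|=J_1+\dots+J_k$, $J!=J_1!\cdots J_k!$, $H_J(x)=\prod_{i=1}^k h_{J_i}(x_i)$ and $\widetilde f(J)=\langle f,H_J\rangle/\sqrt{J!}$. A measurable function $g:\mathbb R^k\to[-1,1]$ is *$d$-resilient* if $\langle g,p\rangle=0$ for every polynomial $p$ of degree at most $d$. For $\alpha\ge 0$, a measurable $f:\mathbb R^k\to[-1,1]$ is *$\alpha$-approximately $d$-resilient* if there is a $d$-resilient function $g:\mathbb R^k\to[-1,1]$ (a *witness*) with $\|f-g\|_1\le\alpha$. For $\tau>0$ let $$\mathrm{Low}_d[f]=\sum_{|J|\le d}\widetilde f(J)\,\frac{H_J}{\sqrt{J!}},\qquad \mathrm{High}_d[f]=f-\mathrm{Low}_d[f],$$ and let $\mathrm{TruncHigh}_{d,\tau}[f](x)$ be $\mathrm{High}_d[f](x)$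 if $|\mathrm{Low}_d[f](x)|\le\tau$, and $0$ otherwise. **Lemma.** There is an absolute constant $k_0$ such that the following holds for all $k\ge k_0$, all $d\ge 2$ and all measurable $f:\mathbb R^k\to\{-1,1\}$. Let $$\gamma:=\sum_{|J|\le d}\widetilde f(J)^2,\qquad \alpha:=\gamma^{0.498}\,(72\ln k)^{d/2}.$$ Then $f$ is $\alpha$-approximately $d$-resilient. Moreover, if $\alpha<1$, there are thresholds $\tau_1,\tau_2,\ldots>0$ such that the functions $f_0:=f$, $f_i:=\mathrm{TruncHigh}_{d,\tau_i}[f_{i-1}]$ $(i\ge1)$ converge in $L^2(N(0,I_k))$ to an essentially bounded function $f^*$, and a witness to the $\alpha$-approximate $d$-resilience of $f$ is given (almost everywhere) by $f^*/\max(1,\|f^*\|_\infty)$. -/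

import Mathlib

open MeasureTheory ProbabilityTheory Filter Topology
open scoped ENNReal

noncomputable section

/-- The standard Gaussian distribution `N(0, I_k)` on `ℝ^k`. -/
def stdGauss (k : ℕ) : Measure (Fin k → ℝ) :=
  Measure.pi fun _ => gaussianReal 0 1

/-- The multivariate (unnormalized, probabilists') Hermite polynomial
`H_J(x) = ∏ i, h_{J i}(x i)`. -/
def hermiteMulti {k : ℕ} (J : Fin k → ℕ) (x : Fin k → ℝ) : ℝ :=
  ∏ i, Polynomial.aeval (x i) (Polynomial.hermite (J i))

/-- `√(J!)`, the `L²` norm of `H_J`, where `J! = ∏ i, (J i)!`. -/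
def sqrtFactorial {k : ℕ} (J : Fin k → ℕ) : ℝ :=
  √((∏ i, (J i).factorial : ℕ) : ℝ)

/-- The Hermite coefficient `f̃(J) = ⟨f, H_J⟩ / √(J!)`. -/
def hermiteCoeff {k : ℕ} (f : (Fin k → ℝ) → ℝ) (J : Fin k → ℕ) : ℝ :=
  (sqrtFactorial J)⁻¹ * ∫ x, f x * hermiteMulti J x ∂(stdGauss k)

/-- The multi-indices `J ∈ ℕ^k` with `|J| = ∑ i, J i ≤ d`. -/
def lowIndices (k d : ℕ) : Finset (Fin k → ℕ) :=
  (Fintype.piFinset fun _ => Finset.range (d + 1)).filter fun J => ∑ i, J i ≤ d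

/-- The Hermite weight of `f` at degrees at most `d`. -/
def hermiteWeight {k : ℕ} (d : ℕ) (f : (Fin k → ℝ) → ℝ) : ℝ :=
  ∑ J ∈ lowIndices k d, hermiteCoeff f J ^ 2

/-- The low-degree part of `f`: its orthogonal projection onto polynomials of degree at most `d`,
written in the orthonormal basis `H_J / √(J!)`. -/
def lowPart {k : ℕ} (d : ℕ) (f : (Fin k → ℝ) → ℝ) (x : Fin k → ℝ) : ℝ :=
  ∑ J ∈ lowIndices k d, hermiteCoeff f J * (hermiteMulti J x / sqrtFactorial J)

/-- The high-degree part of `f`. -/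
def highPart {k : ℕ} (d : ℕ) (f : (Fin k → ℝ) → ℝ) (x : Fin k → ℝ) : ℝ :=
  f x - lowPart d f x

open Classical in
/-- The truncation transformation: the high-degree part of `f` where the low-degree part is at
most `τ` in absolute value, and `0` elsewhere. -/
def truncHigh {k : ℕ} (d : ℕ) (τ : ℝ) (f : (Fin k → ℝ) → ℝ) (x : Fin k → ℝ) : ℝ :=
  if |lowPart d f x| ≤ τ then highPart d f x else 0

/-- The iterates `f_0 = f`, `f_{i+1} = TruncHigh_{d, τ_i}[f_i]`. -/
def truncIter {k : ℕ} (d : ℕ) (τ : ℕ → ℝ) (f : (Fin k → ℝ) → ℝ) : ℕ → (Fin k → ℝ) → ℝ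
  | 0 => f
  | i + 1 => truncHigh d (τ i) (truncIter d τ f i)

/-- `g : ℝ^k → [-1, 1]` is `d`-resilient: it is orthogonal to all polynomials of degree at
most `d`. -/
structure IsResilient {k : ℕ} (d : ℕ) (g : (Fin k → ℝ) → ℝ) : Prop where
  measurable : Measurable g
  mem_Icc : ∀ x, g x ∈ Set.Icc (-1 : ℝ) 1
  orthogonal : ∀ p : MvPolynomial (Fin k) ℝ, p.totalDegree ≤ d →
    ∫ x, g x * MvPolynomial.eval x p ∂(stdGauss k) = 0

/-- `g` is a witness to the `α`-approximate `d`-resilience of `f`. -/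
def IsResilienceWitness {k : ℕ} (d : ℕ) (α : ℝ) (f g : (Fin k → ℝ) → ℝ) : Prop :=
  IsResilient d g ∧ eLpNorm (f - g) 1 (stdGauss k) ≤ ENNReal.ofReal α

/-- `f` is `α`-approximately `d`-resilient. -/
def IsApproxResilient {k : ℕ} (d : ℕ) (α : ℝ) (f : (Fin k → ℝ) → ℝ) : Prop :=
  0 ≤ α ∧ ∃ g : (Fin k → ℝ) → ℝ, IsResilienceWitness d α f g

end

/-!
The argument follows the iteration `f_{i+1} = TruncHigh_{d,τ_i}[f_i]` quantitatively. Write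
`p_i = Low_d[f_i]` and let `γ_i` be its squared `L²` norm, the low-degree weight of `f_i`. Passing
from `f_i` to `f_{i+1}` removes `p_i`, and then the tail of `f_i - p_i` on the set `|p_i| > τ_i`.
As `f_i - p_i` is orthogonal to the polynomials of degree at most `d`, Bessel's inequality bounds
`γ_{i+1}` by the squared `L²` norm of that tail (`hermiteWeight_truncHigh_le`).

The tail is small by hypercontractivity. On `|p_i| > τ_i` one has `|f_i - p_i| ≤ 3 |p_i / τ_i|`
because `|f_i| ≤ 2` and `τ_i ≤ 1`, so a single moment of high order controls it:
`γ_{i+1} ≤ 9 E (p_i / τ_i)⁵¹² ≤ 9 (9^{8d} γ_i / τ_i²)²⁵⁶` (`integral_truncTail_sq_le`). With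
`τ_i = (α / 8) 2⁻ⁱ` and `α` as in the theorem, `γ / α²` is `γ^0.004 (72 ln k)^{-d}`; the 256th power
turns the first factor into more than one full power of `γ`, and the second one absorbs every
constant as soon as `72 ln k` exceeds an absolute bound (`parameter_bounds`). This is the only way
in which the dimension enters. By induction `γ_i ≤ γ 16⁻ⁱ`, while the sup norms stay below
`1 + ∑ τ_i = 1 + α / 4` (`truncIter_invariant`). Hence the iterates converge geometrically in `L²`
to a bounded function `f*` without low-degree part (`exists_limit_truncIter`). The `L²` distance
from `f` to `f*` and the change caused by the rescaling to sup norm at most `1` add up to at most `α`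
(`exists_witness`).

The hypercontractive inequality is proved for polynomials by Gaussian integration by parts. If the
components of `F` satisfy `L F_j = n F_j` for the number operator `L`, then
`n E |F|⁴ ≤ 3 E |F|² |∇F|²`, and `∇F` has components with eigenvalue `n - 1` and
`E |∇F|² = n E |F|²`; Cauchy–Schwarz and induction on `n` give `E |F|⁴ ≤ 9ⁿ (E |F|²)²`
(`gaussExp_sum_sq_sq_le`). Summing over the Hermite chaos components handles polynomials of degree
at most `d` (`gaussExp_pow_four_le`), and repeated squaring reaches the moment of order `512`
(`gaussExp_pow_two_pow_le`).
-/

/-! ### One-dimensional Gaussian integrals and Hermite polynomials -/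

lemma integrable_polynomial_gaussianReal (p : Polynomial ℝ) :
    Integrable (fun x => p.eval x) (gaussianReal 0 1) := by
  induction p using Polynomial.induction_on' with
  | add p q hp hq => exact (hp.add hq).congr (ae_of_all _ fun x => by simp)
  | monomial n a =>
    have h := (memLp_id_gaussianReal (μ := 0) (v := 1) n).integrable_norm_pow'
    have h2 : Integrable (fun x : ℝ => x ^ n) (gaussianReal 0 1) :=
      h.mono' (by fun_prop) (by simp)
    simpa using h2.const_mul a

lemma integrable_gaussianPDFReal_mul_polynomial (p : Polynomial ℝ) :
    Integrable (fun x => gaussianPDFReal 0 1 x * p.eval x) := by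
  have h := integrable_polynomial_gaussianReal p
  rw [gaussianReal_of_var_ne_zero _ one_ne_zero,
    integrable_withDensity_iff_integrable_smul' (measurable_gaussianPDF _ _)
      (ae_of_all _ fun _ => gaussianPDF_lt_top)] at h
  simpa [toReal_gaussianPDF] using h

lemma hasDerivAt_gaussianPDFReal_zero_one (x : ℝ) :
    HasDerivAt (gaussianPDFReal 0 1) (-x * gaussianPDFReal 0 1 x) x := by
  rw [gaussianPDFReal_def]
  have h1 : HasDerivAt (fun x : ℝ => -(x - 0) ^ 2 / (2 * (1 : NNReal))) (-x) x := by
    have := (((hasDerivAt_id x).sub_const 0).pow 2).neg.div_const (2 * ((1 : NNReal) : ℝ))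
    refine this.congr_deriv ?_
    simp; ring
  refine (h1.exp.const_mul (√(2 * Real.pi * (1 : NNReal)))⁻¹).congr_deriv ?_
  ring

/-- Gaussian integration by parts in one variable. -/
lemma integral_gaussianReal_mul_polynomial (p : Polynomial ℝ) :
    ∫ x, x * p.eval x ∂(gaussianReal 0 1) = ∫ x, p.derivative.eval x ∂(gaussianReal 0 1) := by
  rw [integral_gaussianReal_eq_integral_smul one_ne_zero,
    integral_gaussianReal_eq_integral_smul one_ne_zero]
  have h := integral_mul_deriv_eq_deriv_mul_of_integrable
    (u := fun x => p.eval x) (u' := fun x => p.derivative.eval x)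
    (v := gaussianPDFReal 0 1) (v' := fun x => -x * gaussianPDFReal 0 1 x)
    (fun x _ => p.hasDerivAt x) (fun x _ => hasDerivAt_gaussianPDFReal_zero_one x)
    (by
      refine (integrable_gaussianPDFReal_mul_polynomial (-(Polynomial.X * p))).congr
        (ae_of_all _ fun x => ?_)
      simp; ring)
    (by
      refine (integrable_gaussianPDFReal_mul_polynomial p.derivative).congr
        (ae_of_all _ fun x => ?_)
      simp; ring)
    (by
      refine (integrable_gaussianPDFReal_mul_polynomial p).congr (ae_of_all _ fun x => ?_)
      simp; ring)
  have h2 : ∫ x, gaussianPDFReal 0 1 x • (x * p.eval x)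
      = -∫ x, p.eval x * (-x * gaussianPDFReal 0 1 x) := by
    rw [← integral_neg]
    congr 1; ext x; simp; ring
  rw [h2, h, neg_neg]
  congr 1; ext x; simp; ring

/-- The `n`-th moment of the standard Gaussian distribution on `ℝ`. -/
noncomputable def gaussMoment (n : ℕ) : ℝ := ∫ x, x ^ n ∂(gaussianReal 0 1)

lemma gaussMoment_succ (n : ℕ) : gaussMoment (n + 1) = n * gaussMoment (n - 1) := by
  have h := integral_gaussianReal_mul_polynomial (Polynomial.X ^ n)
  simp only [Polynomial.eval_pow, Polynomial.eval_X, Polynomial.derivative_X_pow,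
    Polynomial.eval_mul, Polynomial.eval_C, integral_const_mul] at h
  simpa [gaussMoment, pow_succ'] using h

/-- The probabilists' Hermite polynomial with real coefficients. -/
noncomputable def hermiteReal (n : ℕ) : Polynomial ℝ :=
  (Polynomial.hermite n).map (Int.castRingHom ℝ)

lemma hermiteReal_zero : hermiteReal 0 = 1 := by simp [hermiteReal]

lemma hermiteReal_succ (n : ℕ) :
    hermiteReal (n + 1) = Polynomial.X * hermiteReal n - (hermiteReal n).derivative := by
  simp [hermiteReal, Polynomial.hermite_succ, Polynomial.derivative_map]

lemma aeval_hermite_eq_eval_hermiteReal (n : ℕ) (x : ℝ) :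
    Polynomial.aeval x (Polynomial.hermite n) = (hermiteReal n).eval x := by
  simp [hermiteReal, Polynomial.aeval_def, Polynomial.eval_map]

lemma natDegree_hermiteReal (n : ℕ) : (hermiteReal n).natDegree = n := by
  rw [hermiteReal, (Polynomial.hermite_monic n).natDegree_map, Polynomial.natDegree_hermite]

lemma hermiteReal_monic (n : ℕ) : (hermiteReal n).Monic := (Polynomial.hermite_monic n).map _

lemma derivative_hermiteReal_succ (n : ℕ) :
    (hermiteReal (n + 1)).derivative = ((n : ℝ) + 1) • hermiteReal n := by
  induction n with
  | zero => simp [hermiteReal_succ, hermiteReal_zero]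
  | succ n ih =>
    rw [hermiteReal_succ (n + 1), Polynomial.derivative_sub, Polynomial.derivative_mul, ih,
      Polynomial.derivative_smul, Polynomial.derivative_X, one_mul, mul_smul_comm, add_sub_assoc,
      ← smul_sub, ← hermiteReal_succ]
    push_cast
    module

/-- The Hermite differential equation. -/
lemma X_mul_derivative_hermiteReal (n : ℕ) :
    Polynomial.X * (hermiteReal n).derivative - (hermiteReal n).derivative.derivative
      = (n : ℝ) • hermiteReal n := by
  cases n with
  | zero => simp [hermiteReal_zero]
  | succ n =>
    rw [derivative_hermiteReal_succ, Polynomial.derivative_smul, mul_smul_comm, ← smul_sub,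
      ← hermiteReal_succ, Nat.cast_succ]

lemma integral_hermiteReal_succ_mul (n : ℕ) (p : Polynomial ℝ) :
    ∫ x, (hermiteReal (n + 1) * p).eval x ∂(gaussianReal 0 1)
      = ∫ x, (hermiteReal n * p.derivative).eval x ∂(gaussianReal 0 1) := by
  have h := integral_gaussianReal_mul_polynomial (hermiteReal n * p)
  have h3 : ∫ x, (hermiteReal (n + 1) * p).eval x ∂(gaussianReal 0 1)
      = (∫ x, x * (hermiteReal n * p).eval x ∂(gaussianReal 0 1))
        - ∫ x, ((hermiteReal n).derivative * p).eval x ∂(gaussianReal 0 1) := by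
    rw [← integral_sub _ (integrable_polynomial_gaussianReal _)]
    · congr 1; ext x; simp [hermiteReal_succ]; ring
    · exact (integrable_polynomial_gaussianReal (Polynomial.X * (hermiteReal n * p))).congr
        (ae_of_all _ fun x => by simp)
  rw [h3, h, ← integral_sub (integrable_polynomial_gaussianReal _)
    (integrable_polynomial_gaussianReal _)]
  congr 1; ext x; simp

lemma integral_hermiteReal_mul_of_lt (n : ℕ) (p : Polynomial ℝ) (h : p.natDegree < n) :
    ∫ x, (hermiteReal n * p).eval x ∂(gaussianReal 0 1) = 0 := by
  induction n generalizing p with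
  | zero => omega
  | succ n ih =>
    rw [integral_hermiteReal_succ_mul]
    rcases Nat.eq_zero_or_pos p.natDegree with h0 | h0
    · rw [Polynomial.eq_C_of_natDegree_eq_zero h0]; simp
    · exact ih _ (by have := Polynomial.natDegree_derivative_lt h0.ne'; omega)

lemma integral_hermiteReal_mul_self (n : ℕ) :
    ∫ x, (hermiteReal n * hermiteReal n).eval x ∂(gaussianReal 0 1) = n.factorial := by
  induction n with
  | zero => simp [hermiteReal_zero]
  | succ n ih =>
    rw [integral_hermiteReal_succ_mul, derivative_hermiteReal_succ, mul_smul_comm]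
    simp only [Polynomial.eval_smul, smul_eq_mul, integral_const_mul, ih]
    push_cast [Nat.factorial_succ]; ring

lemma integral_hermiteReal_mul (m n : ℕ) :
    ∫ x, (hermiteReal m).eval x * (hermiteReal n).eval x ∂(gaussianReal 0 1)
      = if m = n then (m.factorial : ℝ) else 0 := by
  simp_rw [← Polynomial.eval_mul]
  rcases lt_trichotomy m n with h | rfl | h
  · rw [if_neg h.ne, mul_comm]
    exact integral_hermiteReal_mul_of_lt _ _ (by rwa [natDegree_hermiteReal])
  · rw [if_pos rfl, integral_hermiteReal_mul_self]
  · rw [if_neg h.ne']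
    exact integral_hermiteReal_mul_of_lt _ _ (by rwa [natDegree_hermiteReal])

lemma exists_eq_sum_hermiteReal (n : ℕ) (p : Polynomial ℝ) (hp : p.natDegree < n) :
    ∃ c : ℕ → ℝ, p = ∑ m ∈ Finset.range n, c m • hermiteReal m := by
  induction n generalizing p with
  | zero => omega
  | succ n ih =>
    rcases Nat.eq_zero_or_pos n with rfl | hn
    · refine ⟨fun _ => p.coeff 0, ?_⟩
      rw [Polynomial.eq_C_of_natDegree_eq_zero (by omega : p.natDegree = 0)]
      simp [hermiteReal_zero, Polynomial.smul_eq_C_mul]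
    · have hlt : (p - p.coeff n • hermiteReal n).natDegree < n := by
        have h0 : (p - p.coeff n • hermiteReal n).coeff n = 0 := by
          have : (hermiteReal n).coeff n = 1 := by
            have := hermiteReal_monic n
            rwa [Polynomial.Monic, Polynomial.leadingCoeff, natDegree_hermiteReal] at this
          simp [this]
        have hle : (p - p.coeff n • hermiteReal n).natDegree ≤ n := by
          refine (Polynomial.natDegree_sub_le _ _).trans (max_le (by omega) ?_)
          exact (Polynomial.natDegree_smul_le _ _).trans (natDegree_hermiteReal n).le
        rcases hle.lt_or_eq with h | h
        · exact h
        · exfalso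
          have : (p - p.coeff n • hermiteReal n) = 0 := by
            rw [← Polynomial.leadingCoeff_eq_zero, Polynomial.leadingCoeff, h, h0]
          rw [this] at h; simp at h; omega
      obtain ⟨c, hc⟩ := ih _ hlt
      refine ⟨fun m => if m = n then p.coeff n else c m, ?_⟩
      have hs : ∑ m ∈ Finset.range n, (if m = n then p.coeff n else c m) • hermiteReal m
          = ∑ m ∈ Finset.range n, c m • hermiteReal m :=
        Finset.sum_congr rfl fun m hm => by rw [if_neg (Finset.mem_range.mp hm).ne]
      simp only [Finset.sum_range_succ, hs, ← hc, if_true, sub_add_cancel]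

/-! ### Gaussian expectations of polynomials in several variables -/

instance (k : ℕ) : IsProbabilityMeasure (stdGauss k) := by
  unfold stdGauss; infer_instance

lemma eval_monomial_eq_prod {k : ℕ} (s : Fin k →₀ ℕ) (a : ℝ) (x : Fin k → ℝ) :
    MvPolynomial.eval x (MvPolynomial.monomial s a) = a * ∏ i, x i ^ s i := by
  rw [MvPolynomial.eval_monomial, Finsupp.prod_fintype _ _ (by simp)]

lemma integrable_mvPolynomial_eval {k : ℕ} (p : MvPolynomial (Fin k) ℝ) :
    Integrable (fun x => MvPolynomial.eval x p) (stdGauss k) := by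
  induction p using MvPolynomial.induction_on' with
  | add p q hp hq => exact (hp.add hq).congr (ae_of_all _ fun x => by simp)
  | monomial s a =>
    simp_rw [eval_monomial_eq_prod]
    refine Integrable.const_mul ?_ a
    refine Integrable.fintype_prod (f := fun i (y : ℝ) => y ^ s i) fun i => ?_
    simpa using integrable_polynomial_gaussianReal (Polynomial.X ^ s i)

/-- The expectation of a polynomial under the standard Gaussian distribution. -/
noncomputable def gaussExp (k : ℕ) : MvPolynomial (Fin k) ℝ →ₗ[ℝ] ℝ where
  toFun p := ∫ x, MvPolynomial.eval x p ∂(stdGauss k)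
  map_add' p q := by
    simp only [map_add]
    exact integral_add (integrable_mvPolynomial_eval p) (integrable_mvPolynomial_eval q)
  map_smul' c p := by
    simp only [MvPolynomial.smul_eval, integral_const_mul, RingHom.id_apply, smul_eq_mul]

lemma gaussExp_apply {k : ℕ} (p : MvPolynomial (Fin k) ℝ) :
    gaussExp k p = ∫ x, MvPolynomial.eval x p ∂(stdGauss k) := rfl

lemma gaussExp_mono {k : ℕ} {p q : MvPolynomial (Fin k) ℝ}
    (h : ∀ x, MvPolynomial.eval x p ≤ MvPolynomial.eval x q) : gaussExp k p ≤ gaussExp k q :=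
  integral_mono (integrable_mvPolynomial_eval p) (integrable_mvPolynomial_eval q) h

lemma gaussExp_nonneg {k : ℕ} {p : MvPolynomial (Fin k) ℝ}
    (h : ∀ x, 0 ≤ MvPolynomial.eval x p) : 0 ≤ gaussExp k p :=
  integral_nonneg h

lemma gaussExp_C {k : ℕ} (a : ℝ) : gaussExp k (MvPolynomial.C a) = a := by
  simp [gaussExp_apply]

/-- The Cauchy–Schwarz inequality for Gaussian expectations of polynomials. -/
lemma gaussExp_mul_sq_le {k : ℕ} (p q : MvPolynomial (Fin k) ℝ) :
    gaussExp k (p * q) ^ 2 ≤ gaussExp k (p ^ 2) * gaussExp k (q ^ 2) := by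
  -- the quadratic polynomial `t ↦ E (t p + q)²` is nonnegative
  have h : ∀ t : ℝ, 0 ≤ gaussExp k (p ^ 2) * (t * t) + 2 * gaussExp k (p * q) * t
      + gaussExp k (q ^ 2) := by
    intro t
    have h0 : 0 ≤ gaussExp k ((t • p + q) ^ 2) := gaussExp_nonneg fun x => by
      rw [map_pow]; positivity
    have h1 : (t • p + q) ^ 2 = (t * t) • p ^ 2 + (2 * t) • (p * q) + q ^ 2 := by
      simp only [MvPolynomial.smul_eq_C_mul, map_mul, map_ofNat]; ring
    rw [h1, map_add, map_add, map_smul, map_smul, smul_eq_mul, smul_eq_mul] at h0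
    linarith
  have := discrim_le_zero h
  rw [discrim] at this
  nlinarith

lemma gaussExp_monomial {k : ℕ} (s : Fin k →₀ ℕ) (a : ℝ) :
    gaussExp k (MvPolynomial.monomial s a) = a * ∏ i, gaussMoment (s i) := by
  simp_rw [gaussExp_apply, eval_monomial_eq_prod, integral_const_mul]
  rw [stdGauss, integral_fintype_prod_eq_prod (fun i (y : ℝ) => y ^ s i)]
  rfl

/-- Gaussian integration by parts. -/
lemma gaussExp_X_mul {k : ℕ} (i : Fin k) (p : MvPolynomial (Fin k) ℝ) :
    gaussExp k (MvPolynomial.X i * p) = gaussExp k (MvPolynomial.pderiv i p) := by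
  induction p using MvPolynomial.induction_on' with
  | add p q hp hq => simp only [mul_add, map_add, hp, hq]
  | monomial s a =>
    rw [MvPolynomial.pderiv_monomial, MvPolynomial.X, MvPolynomial.monomial_mul,
      gaussExp_monomial, gaussExp_monomial,
      ← Finset.mul_prod_erase Finset.univ
        (fun j => gaussMoment ((Finsupp.single i 1 + s : Fin k →₀ ℕ) j)) (Finset.mem_univ i),
      ← Finset.mul_prod_erase (a := i) Finset.univ
        (fun j => gaussMoment ((s - Finsupp.single i 1 : Fin k →₀ ℕ) j)) (Finset.mem_univ i)]
    have h : ∀ j ∈ Finset.univ.erase i, gaussMoment ((Finsupp.single i 1 + s : Fin k →₀ ℕ) j)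
        = gaussMoment ((s - Finsupp.single i 1 : Fin k →₀ ℕ) j) := by
      intro j hj
      have hji : i ≠ j := (Finset.ne_of_mem_erase hj).symm
      simp [hji]
    rw [Finset.prod_congr rfl h]
    simp only [Finsupp.add_apply, Finsupp.single_eq_same, Finsupp.tsub_apply, add_comm 1,
      gaussMoment_succ]
    ring

/-- The Ornstein–Uhlenbeck (number) operator `p ↦ ∑ i, (x_i ∂_i p - ∂_i² p)`. -/
noncomputable def numberOp {k : ℕ} (p : MvPolynomial (Fin k) ℝ) : MvPolynomial (Fin k) ℝ :=
  ∑ i, (MvPolynomial.X i * MvPolynomial.pderiv i p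
    - MvPolynomial.pderiv i (MvPolynomial.pderiv i p))

lemma gaussExp_mul_numberOp {k : ℕ} (u v : MvPolynomial (Fin k) ℝ) :
    gaussExp k (u * numberOp v)
      = ∑ i, gaussExp k (MvPolynomial.pderiv i u * MvPolynomial.pderiv i v) := by
  rw [numberOp, Finset.mul_sum, map_sum]
  refine Finset.sum_congr rfl fun i _ => ?_
  rw [mul_sub, map_sub, mul_left_comm, gaussExp_X_mul, MvPolynomial.pderiv_mul, map_add]
  ring

lemma pderiv_pderiv_comm {k : ℕ} (i j : Fin k) (p : MvPolynomial (Fin k) ℝ) :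
    MvPolynomial.pderiv i (MvPolynomial.pderiv j p)
      = MvPolynomial.pderiv j (MvPolynomial.pderiv i p) := by
  classical
  ext m
  simp only [MvPolynomial.coeff_pderiv, Finsupp.add_apply, add_right_comm m, Finsupp.single_apply]
  rcases eq_or_ne i j with rfl | h
  · rfl
  · simp [h, h.symm]; ring

lemma pderiv_numberOp {k : ℕ} (i : Fin k) (p : MvPolynomial (Fin k) ℝ) :
    MvPolynomial.pderiv i (numberOp p)
      = numberOp (MvPolynomial.pderiv i p) + MvPolynomial.pderiv i p := by
  classical
  have h : ∀ j, MvPolynomial.pderiv i (MvPolynomial.X j * MvPolynomial.pderiv j p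
        - MvPolynomial.pderiv j (MvPolynomial.pderiv j p))
      = (MvPolynomial.X j * MvPolynomial.pderiv j (MvPolynomial.pderiv i p)
        - MvPolynomial.pderiv j (MvPolynomial.pderiv j (MvPolynomial.pderiv i p)))
        + if j = i then MvPolynomial.pderiv i p else 0 := by
    intro j
    rw [map_sub, MvPolynomial.pderiv_mul, pderiv_pderiv_comm i j (MvPolynomial.pderiv j p),
      pderiv_pderiv_comm i j p]
    rcases eq_or_ne j i with rfl | h
    · simp; ring
    · simp [h]
  rw [numberOp, map_sum, Finset.sum_congr rfl fun j _ => h j, Finset.sum_add_distrib,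
    Finset.sum_ite_eq' Finset.univ i, if_pos (Finset.mem_univ i), numberOp]

lemma totalDegree_pderiv_le {k : ℕ} (i : Fin k) (p : MvPolynomial (Fin k) ℝ) (n : ℕ)
    (h : p.totalDegree ≤ n + 1) : (MvPolynomial.pderiv i p).totalDegree ≤ n := by
  refine Finset.sup_le fun s hs => ?_
  rw [MvPolynomial.mem_support_iff, MvPolynomial.coeff_pderiv] at hs
  have h1 := MvPolynomial.le_totalDegree
    (MvPolynomial.mem_support_iff.mpr (left_ne_zero_of_mul hs))
  rw [Finsupp.sum_add_index' (by simp) (by simp), Finsupp.sum_single_index rfl] at h1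
  omega

/-! ### Hermite polynomials in several variables -/

/-- The polynomial `H_J = ∏ i, h_{J i}(X i)`. -/
noncomputable def hermiteMv {k : ℕ} (J : Fin k → ℕ) : MvPolynomial (Fin k) ℝ :=
  ∏ i, Polynomial.aeval (MvPolynomial.X i) (hermiteReal (J i))

lemma eval_aeval_X {k : ℕ} (x : Fin k → ℝ) (i : Fin k) (q : Polynomial ℝ) :
    MvPolynomial.eval x (Polynomial.aeval (MvPolynomial.X i) q) = q.eval (x i) := by
  induction q using Polynomial.induction_on' with
  | add p q hp hq => simp [hp, hq]
  | monomial n a => simp [Polynomial.aeval_monomial]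

lemma eval_hermiteMv {k : ℕ} (J : Fin k → ℕ) (x : Fin k → ℝ) :
    MvPolynomial.eval x (hermiteMv J) = hermiteMulti J x := by
  simp [hermiteMv, hermiteMulti, map_prod, eval_aeval_X, aeval_hermite_eq_eval_hermiteReal]

lemma totalDegree_hermiteMv_le {k : ℕ} (J : Fin k → ℕ) :
    (hermiteMv J).totalDegree ≤ ∑ i, J i := by
  refine (MvPolynomial.totalDegree_finsetProd _ _).trans (Finset.sum_le_sum fun i _ => ?_)
  rw [Polynomial.aeval_eq_sum_range, natDegree_hermiteReal]
  refine MvPolynomial.totalDegree_finsetSum_le fun n hn => ?_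
  refine (MvPolynomial.totalDegree_smul_le _ _).trans ?_
  rw [MvPolynomial.totalDegree_X_pow]
  exact Nat.lt_succ_iff.mp (Finset.mem_range.mp hn)

lemma numberOp_hermiteMv {k : ℕ} (J : Fin k → ℕ) :
    numberOp (hermiteMv J) = ((∑ i, J i : ℕ) : ℝ) • hermiteMv J := by
  classical
  push_cast
  rw [numberOp, Finset.sum_smul]
  refine Finset.sum_congr rfl fun i _ => ?_
  set A : MvPolynomial (Fin k) ℝ :=
    ∏ j ∈ Finset.univ.erase i, Polynomial.aeval (MvPolynomial.X j) (hermiteReal (J j)) with hA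
  have hH : hermiteMv J = Polynomial.aeval (MvPolynomial.X i) (hermiteReal (J i)) * A :=
    (Finset.mul_prod_erase _ _ (Finset.mem_univ i)).symm
  have hA0 : MvPolynomial.pderiv i A = 0 := by
    rw [hA]
    refine Finset.prod_induction _ (fun q => MvPolynomial.pderiv i q = 0)
      (fun p q hp hq => by rw [MvPolynomial.pderiv_mul, hp, hq, zero_mul, mul_zero, add_zero])
      MvPolynomial.pderiv_one fun j hj => ?_
    rw [Derivation.map_aeval, MvPolynomial.pderiv_X_of_ne (Finset.ne_of_mem_erase hj), smul_zero]
  have hd : ∀ q : Polynomial ℝ,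
      MvPolynomial.pderiv i (Polynomial.aeval (MvPolynomial.X i) q * A)
        = Polynomial.aeval (MvPolynomial.X i) q.derivative * A := by
    intro q
    rw [MvPolynomial.pderiv_mul, hA0, Derivation.map_aeval, MvPolynomial.pderiv_X_self, smul_eq_mul,
      mul_one, mul_zero, add_zero]
  rw [hH, hd, hd, ← mul_assoc, ← sub_mul]
  have := congrArg (Polynomial.aeval (MvPolynomial.X i : MvPolynomial (Fin k) ℝ))
    (X_mul_derivative_hermiteReal (J i))
  rw [map_sub, map_mul, Polynomial.aeval_X, map_smul] at this
  rw [this, smul_mul_assoc]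

/-- The Hermite polynomials are orthogonal. -/
lemma gaussExp_hermiteMv_mul {k : ℕ} (J K : Fin k → ℕ) :
    gaussExp k (hermiteMv J * hermiteMv K) = if J = K then sqrtFactorial J ^ 2 else 0 := by
  have h1 : gaussExp k (hermiteMv J * hermiteMv K)
      = ∏ i, if J i = K i then ((J i).factorial : ℝ) else 0 := by
    simp_rw [gaussExp_apply, map_mul, hermiteMv, map_prod, eval_aeval_X, ← Finset.prod_mul_distrib]
    rw [stdGauss, integral_fintype_prod_eq_prod
      (fun i (y : ℝ) => (hermiteReal (J i)).eval y * (hermiteReal (K i)).eval y)]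
    simp_rw [integral_hermiteReal_mul]
  rw [h1]
  split_ifs with h
  · subst h
    rw [sqrtFactorial, Real.sq_sqrt (by positivity)]
    simp
  · obtain ⟨i, hi⟩ := Function.ne_iff.mp h
    exact Finset.prod_eq_zero (Finset.mem_univ i) (if_neg hi)

lemma sqrtFactorial_pos {k : ℕ} (J : Fin k → ℕ) : 0 < sqrtFactorial J := by
  rw [sqrtFactorial]
  refine Real.sqrt_pos.mpr ?_
  exact_mod_cast Finset.prod_pos fun i _ => Nat.factorial_pos (J i)

/-- The orthonormal Hermite basis `H_J / √(J!)`. -/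
noncomputable def hermiteBasis {k : ℕ} (J : Fin k → ℕ) : MvPolynomial (Fin k) ℝ :=
  (sqrtFactorial J)⁻¹ • hermiteMv J

lemma gaussExp_hermiteBasis_mul {k : ℕ} (J K : Fin k → ℕ) :
    gaussExp k (hermiteBasis J * hermiteBasis K) = if J = K then 1 else 0 := by
  rw [hermiteBasis, hermiteBasis, smul_mul_smul_comm, map_smul, gaussExp_hermiteMv_mul]
  split_ifs with h
  · subst h
    have := (sqrtFactorial_pos J).ne'
    rw [smul_eq_mul]; field_simp
  · simp

lemma mem_lowIndices {k d : ℕ} (J : Fin k → ℕ) : J ∈ lowIndices k d ↔ ∑ i, J i ≤ d := by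
  simp only [lowIndices, Finset.mem_filter, Fintype.mem_piFinset, Finset.mem_range,
    and_iff_right_iff_imp]
  intro h i
  exact Nat.lt_succ_iff.mpr ((Finset.single_le_sum (fun _ _ => Nat.zero_le _)
    (Finset.mem_univ i)).trans h)

/-- The Hermite polynomials of degree at most `d` span the polynomials of degree at most `d`. -/
lemma mem_span_hermiteBasis {k d : ℕ} (p : MvPolynomial (Fin k) ℝ) (hp : p.totalDegree ≤ d) :
    p ∈ Submodule.span ℝ (hermiteBasis '' (lowIndices k d : Set (Fin k → ℕ))) := by
  classical
  rw [p.as_sum]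
  refine Submodule.sum_mem _ fun s hs => ?_
  have hsd : ∑ i, s i ≤ d := by
    have := (MvPolynomial.le_totalDegree hs).trans hp
    rwa [Finsupp.sum_fintype _ _ (by simp)] at this
  choose c hc using fun n => exists_eq_sum_hermiteReal (n + 1) (Polynomial.X ^ n) (by simp)
  have hX : ∀ i, (MvPolynomial.X i ^ s i : MvPolynomial (Fin k) ℝ)
      = ∑ m ∈ Finset.range (s i + 1), c (s i) m •
        Polynomial.aeval (MvPolynomial.X i) (hermiteReal m) := by
    intro i
    have := congrArg (Polynomial.aeval (MvPolynomial.X i : MvPolynomial (Fin k) ℝ)) (hc (s i))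
    simpa using this
  have hmon : MvPolynomial.monomial s (p.coeff s)
      = p.coeff s • ∏ i, (MvPolynomial.X i ^ s i : MvPolynomial (Fin k) ℝ) := by
    rw [MvPolynomial.monomial_eq, Finsupp.prod_fintype _ _ (by simp), MvPolynomial.smul_eq_C_mul]
  rw [hmon, Finset.prod_congr rfl fun i _ => hX i, Finset.prod_univ_sum]
  refine Submodule.smul_mem _ _ (Submodule.sum_mem _ fun J hJ => ?_)
  rw [Finset.prod_smul]
  refine Submodule.smul_mem _ _ ?_
  have hJd : J ∈ lowIndices k d := by
    rw [mem_lowIndices]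
    refine (Finset.sum_le_sum fun i _ => ?_).trans hsd
    exact Nat.lt_succ_iff.mp (Finset.mem_range.mp (Fintype.mem_piFinset.mp hJ i))
  have : hermiteMv J = sqrtFactorial J • hermiteBasis J := by
    rw [hermiteBasis, smul_inv_smul₀ (sqrtFactorial_pos J).ne']
  change hermiteMv J ∈ _
  rw [this]
  exact Submodule.smul_mem _ _ (Submodule.subset_span ⟨J, hJd, rfl⟩)

lemma exists_eq_sum_hermiteBasis {k d : ℕ} (p : MvPolynomial (Fin k) ℝ) (hp : p.totalDegree ≤ d) :
    ∃ c : (Fin k → ℕ) → ℝ, p = ∑ J ∈ lowIndices k d, c J • hermiteBasis J := by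
  obtain ⟨c, hc⟩ := Submodule.mem_span_image_finset_iff_exists_fun ℝ |>.mp
    (mem_span_hermiteBasis p hp)
  classical
  refine ⟨fun J => if h : J ∈ lowIndices k d then c ⟨J, h⟩ else 0, ?_⟩
  rw [← hc, ← Finset.sum_coe_sort (lowIndices k d)]
  exact Finset.sum_congr rfl fun J _ => by simp only [dif_pos J.2, Subtype.coe_eta]

/-! ### Hypercontractivity for polynomials in Gaussian variables -/

/-- Vector-valued (2,4)-hypercontractivity on the `n`-th Wiener chaos: if every component of `F` is
an eigenvector of the number operator with eigenvalue `n`, then `E |F|⁴ ≤ 9ⁿ (E |F|²)²`.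
Integration by parts gives `n E |F|⁴ ≤ 3 E |F|² |∇F|²`, and the components of `∇F` lie in the
chaos of order `n - 1`, with `E |∇F|² = n E |F|²`. -/
lemma gaussExp_sum_sq_sq_le {k : ℕ} (n : ℕ) :
    ∀ (ι : Type) [Fintype ι] (F : ι → MvPolynomial (Fin k) ℝ),
      (∀ j, (F j).totalDegree ≤ n) → (∀ j, numberOp (F j) = (n : ℝ) • F j) →
      gaussExp k ((∑ j, F j ^ 2) ^ 2) ≤ 9 ^ n * gaussExp k (∑ j, F j ^ 2) ^ 2 := by
  induction n with
  | zero =>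
    intro ι _ F hdeg _
    have hC : ∀ j, F j = MvPolynomial.C ((F j).coeff 0) := fun j =>
      MvPolynomial.totalDegree_eq_zero_iff_eq_C.mp (Nat.le_zero.mp (hdeg j))
    have hS : ∑ j, F j ^ 2 = MvPolynomial.C (∑ j, (F j).coeff 0 ^ 2) := by
      rw [map_sum]
      exact Finset.sum_congr rfl fun j _ => by rw [map_pow, ← hC j]
    rw [hS, ← map_pow, gaussExp_C, gaussExp_C, pow_zero, one_mul]
  | succ n ih =>
    intro ι _ F hdeg heig
    set S : MvPolynomial (Fin k) ℝ := ∑ j, F j ^ 2 with hS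
    set DF : ι × Fin k → MvPolynomial (Fin k) ℝ :=
      fun a => MvPolynomial.pderiv a.2 (F a.1) with hDF
    set G : MvPolynomial (Fin k) ℝ := ∑ a, DF a ^ 2 with hG
    set W : Fin k → MvPolynomial (Fin k) ℝ :=
      fun i => ∑ j, F j * MvPolynomial.pderiv i (F j) with hW
    -- the induction hypothesis for the gradient
    have hGG : gaussExp k (G ^ 2) ≤ 9 ^ n * gaussExp k G ^ 2 := by
      refine ih (ι × Fin k) DF (fun a => totalDegree_pderiv_le _ _ _ (hdeg _)) fun a => ?_
      have h := congrArg (MvPolynomial.pderiv a.2) (heig a.1)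
      rw [pderiv_numberOp, Derivation.map_smul] at h
      rw [hDF]
      rw [eq_sub_of_add_eq h]
      push_cast
      module
    have hEG : gaussExp k G = (n + 1) * gaussExp k S := by
      have h : ∀ j, ∑ i, gaussExp k (DF (j, i) ^ 2) = (n + 1) * gaussExp k (F j ^ 2) := by
        intro j
        have := gaussExp_mul_numberOp (F j) (F j)
        rw [heig j, mul_smul_comm, map_smul, smul_eq_mul, ← sq] at this
        push_cast at this
        rw [this]
        simp only [hDF, sq]
      rw [hG, map_sum, Fintype.sum_prod_type, Finset.sum_congr rfl fun j _ => h j,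
        ← Finset.mul_sum, ← map_sum]
    have hDS : ∀ i, MvPolynomial.pderiv i S = 2 * W i := by
      intro i
      rw [hS, map_sum, hW, Finset.mul_sum]
      refine Finset.sum_congr rfl fun j _ => ?_
      rw [sq, MvPolynomial.pderiv_mul]; ring
    have hmain : (n + 1) * gaussExp k (S ^ 2) = gaussExp k (S * G + 2 * ∑ i, W i ^ 2) := by
      have h1 : ∀ j, (n + 1) * gaussExp k (S * F j ^ 2)
          = gaussExp k (S * ∑ i, DF (j, i) ^ 2)
            + ∑ i, gaussExp k (2 * W i * (F j * MvPolynomial.pderiv i (F j))) := by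
        intro j
        have := gaussExp_mul_numberOp (S * F j) (F j)
        rw [heig j, mul_smul_comm, map_smul, smul_eq_mul, mul_assoc, ← sq] at this
        push_cast at this
        rw [this, Finset.mul_sum, map_sum, ← Finset.sum_add_distrib]
        refine Finset.sum_congr rfl fun i _ => ?_
        rw [← map_add, MvPolynomial.pderiv_mul, hDS]
        congr 1
        simp only [hDF]; ring
      calc (n + 1) * gaussExp k (S ^ 2) = ∑ j, (n + 1) * gaussExp k (S * F j ^ 2) := by
            rw [← Finset.mul_sum, ← map_sum, ← Finset.mul_sum, ← hS, sq]
        _ = gaussExp k (S * G + 2 * ∑ i, W i ^ 2) := by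
            rw [Finset.sum_congr rfl fun j _ => h1 j, Finset.sum_add_distrib, map_add]
            congr 1
            · rw [hG, Fintype.sum_prod_type, Finset.mul_sum, map_sum]
            · rw [Finset.sum_comm, Finset.mul_sum, map_sum]
              refine Finset.sum_congr rfl fun i _ => ?_
              rw [← map_sum (gaussExp k), ← Finset.mul_sum, sq, ← mul_assoc]
    have hle : gaussExp k (S * G + 2 * ∑ i, W i ^ 2) ≤ gaussExp k ((3 : ℝ) • (S * G)) := by
      refine gaussExp_mono fun x => ?_
      have hWx : ∀ i, MvPolynomial.eval x (W i) ^ 2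
          ≤ MvPolynomial.eval x S * ∑ j, MvPolynomial.eval x (DF (j, i)) ^ 2 := by
        intro i
        simp only [hW, hS, hDF, map_sum, map_mul, map_pow]
        exact Finset.sum_mul_sq_le_sq_mul_sq _ _ _
      have hsum : ∑ i, MvPolynomial.eval x (W i) ^ 2
          ≤ MvPolynomial.eval x S * MvPolynomial.eval x G := by
        refine (Finset.sum_le_sum fun i _ => hWx i).trans_eq ?_
        rw [← Finset.mul_sum, hG, Fintype.sum_prod_type, Finset.sum_comm]
        simp only [map_pow, map_sum]
      simp only [map_add, map_mul, map_sum, map_pow, MvPolynomial.smul_eval, map_ofNat]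
      linarith
    rw [← hmain, map_smul, smul_eq_mul] at hle
    have hCS := gaussExp_mul_sq_le S G
    have hS2 : 0 ≤ gaussExp k (S ^ 2) := gaussExp_nonneg fun x => by rw [map_pow]; positivity
    rcases hS2.eq_or_lt with h0 | hpos
    · rw [← h0]; positivity
    · rw [hEG] at hGG
      have h1 : ((n + 1) * gaussExp k (S ^ 2)) ^ 2 ≤ (3 * gaussExp k (S * G)) ^ 2 :=
        pow_le_pow_left₀ (by positivity) hle 2
      have h2 : gaussExp k (S ^ 2) * ((n + 1) ^ 2 * gaussExp k (S ^ 2))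
          ≤ gaussExp k (S ^ 2) * ((n + 1) ^ 2 * (9 ^ (n + 1) * gaussExp k S ^ 2)) := by
        calc gaussExp k (S ^ 2) * ((n + 1) ^ 2 * gaussExp k (S ^ 2))
            = ((n + 1) * gaussExp k (S ^ 2)) ^ 2 := by ring
          _ ≤ 9 * (gaussExp k (S ^ 2) * gaussExp k (G ^ 2)) := by linarith
          _ ≤ 9 * (gaussExp k (S ^ 2) * (9 ^ n * ((n + 1) * gaussExp k S) ^ 2)) := by gcongr
          _ = _ := by ring
      exact le_of_mul_le_mul_left (le_of_mul_le_mul_left h2 hpos) (by positivity)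

lemma numberOp_sum_smul {k : ℕ} {ι : Type*} (A : Finset ι) (c : ι → ℝ)
    (q : ι → MvPolynomial (Fin k) ℝ) :
    numberOp (∑ J ∈ A, c J • q J) = ∑ J ∈ A, c J • numberOp (q J) := by
  simp only [numberOp, map_sum, Derivation.map_smul, Finset.mul_sum, mul_smul_comm, ← smul_sub,
    ← Finset.sum_sub_distrib, Finset.smul_sum]
  exact Finset.sum_comm

lemma numberOp_hermiteBasis {k : ℕ} (J : Fin k → ℕ) :
    numberOp (hermiteBasis J) = ((∑ i, J i : ℕ) : ℝ) • hermiteBasis J := by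
  have := numberOp_sum_smul {J} (fun J => (sqrtFactorial J)⁻¹) hermiteMv
  simp only [Finset.sum_singleton] at this
  rw [hermiteBasis, this, numberOp_hermiteMv, smul_comm]

lemma totalDegree_hermiteBasis_le {k : ℕ} (J : Fin k → ℕ) :
    (hermiteBasis J).totalDegree ≤ ∑ i, J i :=
  (MvPolynomial.totalDegree_smul_le _ _).trans (totalDegree_hermiteMv_le J)

/-- Parseval's identity for Hermite expansions. -/
lemma gaussExp_sum_hermiteBasis_sq {k : ℕ} (A : Finset (Fin k → ℕ)) (c : (Fin k → ℕ) → ℝ) :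
    gaussExp k ((∑ J ∈ A, c J • hermiteBasis J) ^ 2) = ∑ J ∈ A, c J ^ 2 := by
  classical
  rw [sq, Finset.sum_mul_sum, map_sum]
  refine Finset.sum_congr rfl fun J hJ => ?_
  simp only [map_sum, smul_mul_smul_comm, map_smul, gaussExp_hermiteBasis_mul, smul_eq_mul,
    mul_ite, mul_one, mul_zero]
  rw [Finset.sum_ite_eq, if_pos hJ, sq]

/-- (2,4)-hypercontractivity for polynomials of degree at most `D`. -/
lemma gaussExp_pow_four_le {k : ℕ} (D : ℕ) (p : MvPolynomial (Fin k) ℝ) (hp : p.totalDegree ≤ D) :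
    gaussExp k (p ^ 4) ≤ 9 ^ (D + 1) * gaussExp k (p ^ 2) ^ 2 := by
  classical
  obtain ⟨c, hc⟩ := exists_eq_sum_hermiteBasis p hp
  set A : ℕ → Finset (Fin k → ℕ) := fun n => (lowIndices k D).filter fun J => ∑ i, J i = n with hA
  -- the homogeneous chaos components of `p`
  set P : ℕ → MvPolynomial (Fin k) ℝ := fun n => ∑ J ∈ A n, c J • hermiteBasis J with hP
  obtain ⟨e, he⟩ : ∃ e : ℕ → ℝ, ∀ n, e n = gaussExp k (P n ^ 2) := ⟨_, fun _ => rfl⟩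
  have he0 : ∀ n, 0 ≤ e n := fun n => by
    rw [he]; exact gaussExp_nonneg fun x => by rw [map_pow]; positivity
  have hmaps : ∀ J ∈ lowIndices k D, ∑ i, J i ∈ Finset.range (D + 1) := fun J hJ =>
    Finset.mem_range.mpr (Nat.lt_succ_iff.mpr ((mem_lowIndices J).mp hJ))
  have hpP : p = ∑ n ∈ Finset.range (D + 1), P n := by
    rw [hc, ← Finset.sum_fiberwise_of_maps_to hmaps]
  have hpe : gaussExp k (p ^ 2) = ∑ n ∈ Finset.range (D + 1), e n := by
    simp only [he, hP, gaussExp_sum_hermiteBasis_sq]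
    rw [hc, gaussExp_sum_hermiteBasis_sq, ← Finset.sum_fiberwise_of_maps_to hmaps]
  have hP4 : ∀ n, gaussExp k ((P n ^ 2) ^ 2) ≤ 9 ^ n * e n ^ 2 := by
    intro n
    have h := gaussExp_sum_sq_sq_le n Unit (fun _ => P n) (fun _ => ?_) fun _ => ?_
    · simpa [he] using h
    · refine MvPolynomial.totalDegree_finsetSum_le fun J hJ => ?_
      exact (MvPolynomial.totalDegree_smul_le _ _).trans
        ((totalDegree_hermiteBasis_le J).trans (Finset.mem_filter.mp hJ).2.le)
    · rw [hP, numberOp_sum_smul, Finset.smul_sum]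
      refine Finset.sum_congr rfl fun J hJ => ?_
      rw [numberOp_hermiteBasis, (Finset.mem_filter.mp hJ).2, smul_comm]
  have hmn : ∀ m n, gaussExp k (P m ^ 2 * P n ^ 2) ≤ 3 ^ m * 3 ^ n * (e m * e n) := by
    intro m n
    have hm := he0 m
    have hn := he0 n
    refine le_of_abs_le (abs_le_of_sq_le_sq ((gaussExp_mul_sq_le _ _).trans ?_) (by positivity))
    calc gaussExp k ((P m ^ 2) ^ 2) * gaussExp k ((P n ^ 2) ^ 2)
        ≤ (9 ^ m * e m ^ 2) * (9 ^ n * e n ^ 2) := by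
          refine mul_le_mul (hP4 m) (hP4 n) (gaussExp_nonneg fun x => ?_) (by positivity)
          rw [map_pow]; positivity
      _ = _ := by
          have h9 : ∀ N : ℕ, (9 : ℝ) ^ N = (3 ^ N) ^ 2 := fun N => by
            rw [← pow_mul, mul_comm, pow_mul]; norm_num
          rw [h9 m, h9 n]; ring
  set T : ℝ := ∑ n ∈ Finset.range (D + 1), (3 : ℝ) ^ n with hT
  have hTle : T ^ 2 ≤ 9 ^ (D + 1) := by
    have h : ∀ N : ℕ, ∑ n ∈ Finset.range N, (3 : ℝ) ^ n ≤ 3 ^ N := by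
      intro N
      rw [geom_sum_eq (by norm_num)]
      have : (1 : ℝ) ≤ 3 ^ N := one_le_pow₀ (by norm_num)
      linarith
    calc T ^ 2 ≤ (3 ^ (D + 1)) ^ 2 := pow_le_pow_left₀ (by positivity) (h _) 2
      _ = 9 ^ (D + 1) := by rw [← pow_mul, mul_comm, pow_mul]; norm_num
  set Q : MvPolynomial (Fin k) ℝ :=
    ∑ n ∈ Finset.range (D + 1), ((3 : ℝ) ^ n)⁻¹ • P n ^ 2 with hQ
  have hpQ : gaussExp k (p ^ 4) ≤ gaussExp k (T ^ 2 • Q ^ 2) := by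
    refine gaussExp_mono fun x => ?_
    have h : MvPolynomial.eval x p ^ 2 ≤ T * MvPolynomial.eval x Q := by
      rw [hpP, hQ, map_sum, map_sum]
      refine Finset.sum_sq_le_sum_mul_sum_of_sq_le_mul _ (fun n _ => by positivity)
        (fun n _ => ?_) fun n _ => ?_
      · rw [MvPolynomial.smul_eval, map_pow]; positivity
      · rw [MvPolynomial.smul_eval, map_pow]
        exact (mul_inv_cancel_left₀ (by positivity) _).ge
    rw [map_pow, MvPolynomial.smul_eval, map_pow, ← mul_pow,
      show MvPolynomial.eval x p ^ 4 = (MvPolynomial.eval x p ^ 2) ^ 2 by ring]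
    exact pow_le_pow_left₀ (by positivity) h 2
  have hQe : gaussExp k (Q ^ 2) ≤ gaussExp k (p ^ 2) ^ 2 := by
    rw [hpe, sq (∑ n ∈ _, e n), Finset.sum_mul_sum, hQ, sq, Finset.sum_mul_sum]
    simp only [map_sum]
    refine Finset.sum_le_sum fun m _ => Finset.sum_le_sum fun n _ => ?_
    rw [smul_mul_smul_comm, map_smul, smul_eq_mul]
    calc ((3 : ℝ) ^ m)⁻¹ * (3 ^ n)⁻¹ * gaussExp k (P m ^ 2 * P n ^ 2)
        ≤ ((3 : ℝ) ^ m)⁻¹ * (3 ^ n)⁻¹ * (3 ^ m * 3 ^ n * (e m * e n)) := by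
          have := hmn m n; gcongr
      _ = e m * e n := by field_simp
  rw [map_smul, smul_eq_mul] at hpQ
  calc gaussExp k (p ^ 4) ≤ T ^ 2 * gaussExp k (Q ^ 2) := hpQ
    _ ≤ 9 ^ (D + 1) * gaussExp k (p ^ 2) ^ 2 := by
        refine mul_le_mul hTle hQe (gaussExp_nonneg fun x => ?_) (by positivity)
        rw [map_pow]; positivity

/-- Hypercontractivity from `L²` to `L^{2^{j+1}}`, by applying the (2,4) inequality to the powers
`p, p², p⁴, …`. -/
lemma gaussExp_pow_two_pow_le {k d : ℕ} (hd : 1 ≤ d) (p : MvPolynomial (Fin k) ℝ)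
    (hp : p.totalDegree ≤ d) (j : ℕ) :
    gaussExp k (p ^ 2 ^ (j + 1)) ≤ (9 ^ (j * d) * gaussExp k (p ^ 2)) ^ 2 ^ j := by
  induction j with
  | zero => simp
  | succ j ih =>
    have hdeg : (p ^ 2 ^ j).totalDegree ≤ 2 ^ j * d :=
      (MvPolynomial.totalDegree_pow _ _).trans (Nat.mul_le_mul_left _ hp)
    have h := gaussExp_pow_four_le _ _ hdeg
    rw [← pow_mul, ← pow_mul, ← pow_succ, show 2 ^ j * 4 = 2 ^ (j + 1 + 1) by ring] at h
    have h0 : 0 ≤ gaussExp k (p ^ 2) := gaussExp_nonneg fun x => by rw [map_pow]; positivity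
    have h1 : 0 ≤ gaussExp k (p ^ 2 ^ (j + 1)) := gaussExp_nonneg fun x => by
      rw [map_pow, pow_succ, pow_mul]; positivity
    have hexp : 2 ^ j * d + 1 ≤ d * 2 ^ (j + 1) := by
      have : 1 ≤ 2 ^ j * d := Nat.mul_pos (by positivity) hd
      rw [pow_succ]; nlinarith
    calc gaussExp k (p ^ 2 ^ (j + 1 + 1))
        ≤ 9 ^ (2 ^ j * d + 1) * gaussExp k (p ^ 2 ^ (j + 1)) ^ 2 := h
      _ ≤ 9 ^ (d * 2 ^ (j + 1)) * ((9 ^ (j * d) * gaussExp k (p ^ 2)) ^ 2 ^ j) ^ 2 := by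
          gcongr
          norm_num
      _ = _ := by
          rw [← pow_mul _ (2 ^ j) 2, ← pow_succ, pow_mul 9 d, ← mul_pow, ← mul_assoc, ← pow_add]
          congr 3; ring

/-! ### The low-degree part as an orthogonal projection -/

lemma memLp_two_eval {k : ℕ} (p : MvPolynomial (Fin k) ℝ) :
    MemLp (fun x => MvPolynomial.eval x p) 2 (stdGauss k) := by
  rw [memLp_two_iff_integrable_sq (integrable_mvPolynomial_eval p).aestronglyMeasurable]
  exact (integrable_mvPolynomial_eval (p ^ 2)).congr (ae_of_all _ fun x => by simp)

lemma integrable_mul_eval {k : ℕ} {f : (Fin k → ℝ) → ℝ} (hf : MemLp f 2 (stdGauss k))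
    (p : MvPolynomial (Fin k) ℝ) :
    Integrable (fun x => f x * MvPolynomial.eval x p) (stdGauss k) :=
  hf.integrable_mul (memLp_two_eval p)

lemma eval_hermiteBasis {k : ℕ} (J : Fin k → ℕ) (x : Fin k → ℝ) :
    MvPolynomial.eval x (hermiteBasis J) = hermiteMulti J x / sqrtFactorial J := by
  rw [hermiteBasis, MvPolynomial.smul_eval, eval_hermiteMv, inv_mul_eq_div]

lemma hermiteCoeff_eq_integral {k : ℕ} (f : (Fin k → ℝ) → ℝ) (J : Fin k → ℕ) :
    hermiteCoeff f J = ∫ x, f x * MvPolynomial.eval x (hermiteBasis J) ∂(stdGauss k) := by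
  rw [hermiteCoeff, ← integral_const_mul]
  congr 1; ext x
  rw [eval_hermiteBasis]; ring

/-- The low-degree part of `f` as a polynomial. -/
noncomputable def lowPoly {k : ℕ} (d : ℕ) (f : (Fin k → ℝ) → ℝ) : MvPolynomial (Fin k) ℝ :=
  ∑ J ∈ lowIndices k d, hermiteCoeff f J • hermiteBasis J

lemma eval_lowPoly {k : ℕ} (d : ℕ) (f : (Fin k → ℝ) → ℝ) (x : Fin k → ℝ) :
    MvPolynomial.eval x (lowPoly d f) = lowPart d f x := by
  simp only [lowPoly, map_sum, MvPolynomial.smul_eval, eval_hermiteBasis, lowPart]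

lemma totalDegree_lowPoly_le {k : ℕ} (d : ℕ) (f : (Fin k → ℝ) → ℝ) :
    (lowPoly d f).totalDegree ≤ d :=
  MvPolynomial.totalDegree_finsetSum_le fun J hJ =>
    (MvPolynomial.totalDegree_smul_le _ _).trans
      ((totalDegree_hermiteBasis_le J).trans ((mem_lowIndices J).mp hJ))

lemma gaussExp_lowPoly_sq {k : ℕ} (d : ℕ) (f : (Fin k → ℝ) → ℝ) :
    gaussExp k (lowPoly d f ^ 2) = hermiteWeight d f :=
  gaussExp_sum_hermiteBasis_sq _ _

lemma integral_lowPart_sq {k : ℕ} (d : ℕ) (f : (Fin k → ℝ) → ℝ) :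
    ∫ x, lowPart d f x ^ 2 ∂(stdGauss k) = hermiteWeight d f := by
  rw [← gaussExp_lowPoly_sq, gaussExp_apply]
  simp only [map_pow, eval_lowPoly]

lemma memLp_two_lowPart {k : ℕ} (d : ℕ) (f : (Fin k → ℝ) → ℝ) :
    MemLp (lowPart d f) 2 (stdGauss k) := by
  have h := memLp_two_eval (lowPoly d f)
  simp only [eval_lowPoly] at h
  exact h

lemma measurable_lowPart {k : ℕ} (d : ℕ) (f : (Fin k → ℝ) → ℝ) : Measurable (lowPart d f) := by
  have h : lowPart d f = fun x => MvPolynomial.eval x (lowPoly d f) :=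
    funext fun x => (eval_lowPoly d f x).symm
  rw [h]
  exact (MvPolynomial.continuous_eval _).measurable

lemma hermiteWeight_nonneg {k : ℕ} (d : ℕ) (f : (Fin k → ℝ) → ℝ) : 0 ≤ hermiteWeight d f :=
  Finset.sum_nonneg fun _ _ => sq_nonneg _

lemma hermiteCoeff_sub {k : ℕ} {f g : (Fin k → ℝ) → ℝ} (hf : MemLp f 2 (stdGauss k))
    (hg : MemLp g 2 (stdGauss k)) (J : Fin k → ℕ) :
    hermiteCoeff (fun x => f x - g x) J = hermiteCoeff f J - hermiteCoeff g J := by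
  simp only [hermiteCoeff_eq_integral, sub_mul]
  exact integral_sub (integrable_mul_eval hf _) (integrable_mul_eval hg _)

lemma hermiteCoeff_lowPart {k d : ℕ} (f : (Fin k → ℝ) → ℝ) {J : Fin k → ℕ}
    (hJ : J ∈ lowIndices k d) : hermiteCoeff (lowPart d f) J = hermiteCoeff f J := by
  classical
  rw [hermiteCoeff_eq_integral]
  simp only [← eval_lowPoly, ← map_mul]
  rw [← gaussExp_apply, lowPoly, Finset.sum_mul, map_sum]
  simp only [smul_mul_assoc, map_smul, gaussExp_hermiteBasis_mul, smul_eq_mul, mul_ite, mul_one,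
    mul_zero]
  rw [Finset.sum_ite_eq' (lowIndices k d) J, if_pos hJ]

lemma memLp_two_highPart {k : ℕ} (d : ℕ) {f : (Fin k → ℝ) → ℝ} (hf : MemLp f 2 (stdGauss k)) :
    MemLp (highPart d f) 2 (stdGauss k) :=
  hf.sub (memLp_two_lowPart d f)

lemma hermiteCoeff_highPart {k d : ℕ} {f : (Fin k → ℝ) → ℝ} (hf : MemLp f 2 (stdGauss k))
    {J : Fin k → ℕ} (hJ : J ∈ lowIndices k d) : hermiteCoeff (highPart d f) J = 0 := by
  have h := hermiteCoeff_sub hf (memLp_two_lowPart d f) J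
  rw [hermiteCoeff_lowPart f hJ, sub_self] at h
  exact h

lemma integral_mul_eval_eq_zero {k d : ℕ} {f : (Fin k → ℝ) → ℝ} (hf : MemLp f 2 (stdGauss k))
    (h : ∀ J ∈ lowIndices k d, hermiteCoeff f J = 0) (p : MvPolynomial (Fin k) ℝ)
    (hp : p.totalDegree ≤ d) : ∫ x, f x * MvPolynomial.eval x p ∂(stdGauss k) = 0 := by
  obtain ⟨c, rfl⟩ := exists_eq_sum_hermiteBasis p hp
  simp only [map_sum, MvPolynomial.smul_eval, Finset.mul_sum, mul_left_comm (f _)]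
  rw [integral_finsetSum _ fun J _ => (integrable_mul_eval hf _).const_mul _]
  refine Finset.sum_eq_zero fun J hJ => ?_
  rw [integral_const_mul, ← hermiteCoeff_eq_integral, h J hJ, mul_zero]

/-- Bessel's inequality. -/
lemma hermiteWeight_le_integral_sq {k : ℕ} (d : ℕ) {f : (Fin k → ℝ) → ℝ}
    (hf : MemLp f 2 (stdGauss k)) : hermiteWeight d f ≤ ∫ x, f x ^ 2 ∂(stdGauss k) := by
  have h0 := integral_mul_eval_eq_zero (memLp_two_highPart d hf)
    (fun J hJ => hermiteCoeff_highPart hf hJ) (lowPoly d f) (totalDegree_lowPoly_le d f)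
  simp only [eval_lowPoly] at h0
  have h1 : 0 ≤ ∫ x, highPart d f x ^ 2 ∂(stdGauss k) := integral_nonneg fun x => sq_nonneg _
  have hi1 := (memLp_two_highPart d hf).integrable_sq
  have hi2 := (memLp_two_lowPart d f).integrable_sq
  have hi3 : Integrable (fun x => highPart d f x * lowPart d f x) (stdGauss k) :=
    (memLp_two_highPart d hf).integrable_mul (memLp_two_lowPart d f)
  have hi4 : Integrable (fun x => highPart d f x ^ 2 + 2 * (highPart d f x * lowPart d f x))
      (stdGauss k) := hi1.add (hi3.const_mul 2)
  have h2 : ∫ x, f x ^ 2 ∂(stdGauss k) = ∫ x, highPart d f x ^ 2 ∂(stdGauss k)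
      + 2 * ∫ x, highPart d f x * lowPart d f x ∂(stdGauss k)
      + ∫ x, lowPart d f x ^ 2 ∂(stdGauss k) := by
    rw [← integral_const_mul, ← integral_add hi1 (hi3.const_mul 2),
      ← integral_add hi4 hi2]
    congr 1; ext x
    simp only [highPart]; ring
  rw [h2, h0, integral_lowPart_sq]
  linarith

lemma hermiteWeight_sub_le {k d : ℕ} {f g : (Fin k → ℝ) → ℝ} (hf : MemLp f 2 (stdGauss k))
    (hg : MemLp g 2 (stdGauss k)) :
    hermiteWeight d f ≤ 2 * hermiteWeight d (fun x => f x - g x) + 2 * hermiteWeight d g := by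
  simp only [hermiteWeight, Finset.mul_sum, ← Finset.sum_add_distrib, hermiteCoeff_sub hf hg]
  refine Finset.sum_le_sum fun J _ => ?_
  nlinarith [sq_nonneg (hermiteCoeff f J - 2 * hermiteCoeff g J)]

lemma hermiteWeight_eq_zero_iff {k d : ℕ} {f : (Fin k → ℝ) → ℝ} :
    hermiteWeight d f = 0 ↔ ∀ J ∈ lowIndices k d, hermiteCoeff f J = 0 := by
  simp [hermiteWeight, Finset.sum_eq_zero_iff_of_nonneg fun _ _ => sq_nonneg _]

/-! ### One step of the truncation iteration -/

/-- The part of `High_d[f]` that the truncation discards. -/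
noncomputable def truncTail {k : ℕ} (d : ℕ) (τ : ℝ) (f : (Fin k → ℝ) → ℝ) : (Fin k → ℝ) → ℝ :=
  Set.indicator {x | τ < |lowPart d f x|} (highPart d f)

lemma truncHigh_eq_sub {k : ℕ} (d : ℕ) (τ : ℝ) (f : (Fin k → ℝ) → ℝ) :
    truncHigh d τ f = fun x => highPart d f x - truncTail d τ f x := by
  ext x
  by_cases h : |lowPart d f x| ≤ τ
  · simp [truncHigh, truncTail, h]
  · simp [truncHigh, truncTail, h, not_le.mp h]

lemma memLp_two_truncTail {k : ℕ} (d : ℕ) (τ : ℝ) {f : (Fin k → ℝ) → ℝ}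
    (hf : MemLp f 2 (stdGauss k)) : MemLp (truncTail d τ f) 2 (stdGauss k) :=
  (memLp_two_highPart d hf).indicator
    (measurableSet_lt measurable_const (measurable_lowPart d f).abs)

lemma memLp_two_truncHigh {k : ℕ} (d : ℕ) (τ : ℝ) {f : (Fin k → ℝ) → ℝ}
    (hf : MemLp f 2 (stdGauss k)) : MemLp (truncHigh d τ f) 2 (stdGauss k) := by
  rw [truncHigh_eq_sub]
  exact (memLp_two_highPart d hf).sub (memLp_two_truncTail d τ hf)

lemma abs_truncHigh_le {k : ℕ} (d : ℕ) {τ : ℝ} (hτ : 0 < τ) (f : (Fin k → ℝ) → ℝ)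
    (x : Fin k → ℝ) : |truncHigh d τ f x| ≤ |f x| + τ := by
  rw [truncHigh]
  split_ifs with h
  · exact (abs_sub _ _).trans (by gcongr)
  · rw [abs_zero]; positivity

/-- The truncation leaves only the low-degree weight of the discarded tail. -/
lemma hermiteWeight_truncHigh_le {k : ℕ} (d : ℕ) (τ : ℝ) {f : (Fin k → ℝ) → ℝ}
    (hf : MemLp f 2 (stdGauss k)) :
    hermiteWeight d (truncHigh d τ f) ≤ ∫ x, truncTail d τ f x ^ 2 ∂(stdGauss k) := by
  refine le_trans (le_of_eq ?_) (hermiteWeight_le_integral_sq d (memLp_two_truncTail d τ hf))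
  refine Finset.sum_congr rfl fun J hJ => ?_
  rw [truncHigh_eq_sub, hermiteCoeff_sub (memLp_two_highPart d hf) (memLp_two_truncTail d τ hf),
    hermiteCoeff_highPart hf hJ, zero_sub, neg_sq]

lemma integral_sub_truncHigh_sq_le {k : ℕ} (d : ℕ) (τ : ℝ) {f : (Fin k → ℝ) → ℝ}
    (hf : MemLp f 2 (stdGauss k)) :
    ∫ x, (f x - truncHigh d τ f x) ^ 2 ∂(stdGauss k)
      ≤ 2 * hermiteWeight d f + 2 * ∫ x, truncTail d τ f x ^ 2 ∂(stdGauss k) := by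
  have hi1 := (memLp_two_lowPart d f).integrable_sq
  have hi2 := (memLp_two_truncTail d τ hf).integrable_sq
  rw [← integral_lowPart_sq, ← integral_const_mul, ← integral_const_mul,
    ← integral_add (hi1.const_mul 2) (hi2.const_mul 2)]
  refine integral_mono (hf.sub (memLp_two_truncHigh d τ hf)).integrable_sq
    ((hi1.const_mul 2).add (hi2.const_mul 2)) fun x => ?_
  simp only [truncHigh_eq_sub, highPart]
  nlinarith [sq_nonneg (lowPart d f x - truncTail d τ f x)]

/-- The discarded tail is tiny. Where `|p| > τ`, with `p` the low-degree part of `f`, one has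
`|f - p| ≤ 3 |p / τ| ≤ 3 |p / τ|²⁵⁶`, and hypercontractivity bounds the moment `E p⁵¹²`. -/
lemma integral_truncTail_sq_le {k d : ℕ} (hd : 1 ≤ d) {τ : ℝ} (hτ : 0 < τ) (hτ1 : τ ≤ 1)
    {f : (Fin k → ℝ) → ℝ} (hf : MemLp f 2 (stdGauss k)) (hf2 : ∀ x, |f x| ≤ 2) :
    ∫ x, truncTail d τ f x ^ 2 ∂(stdGauss k)
      ≤ 9 * (9 ^ (8 * d) * hermiteWeight d f / τ ^ 2) ^ 256 := by
  obtain ⟨Q, hQ⟩ : ∃ Q : MvPolynomial (Fin k) ℝ, Q = (9 * (τ ^ 512)⁻¹) • lowPoly d f ^ 512 :=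
    ⟨_, rfl⟩
  have hpt : ∀ x, truncTail d τ f x ^ 2 ≤ MvPolynomial.eval x Q := by
    intro x
    rw [hQ, MvPolynomial.smul_eval, map_pow, eval_lowPoly]
    by_cases h : τ < |lowPart d f x|
    · have h1 : truncTail d τ f x = f x - lowPart d f x := by simp [truncTail, h, highPart]
      set y := |lowPart d f x| / τ with hy
      have hy1 : 1 ≤ y := by rw [hy, one_le_div hτ]; exact h.le
      have hly : |lowPart d f x| ≤ y := by
        rw [hy, le_div_iff₀ hτ]
        exact mul_le_of_le_one_right (abs_nonneg _) hτ1
      have h2 : |f x - lowPart d f x| ≤ 3 * y := by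
        refine (abs_sub _ _).trans ?_
        linarith [hf2 x]
      have h3 : 9 * (τ ^ 512)⁻¹ * lowPart d f x ^ 512 = 9 * y ^ 512 := by
        rw [hy, div_pow, Even.pow_abs ⟨256, rfl⟩]; ring
      rw [h1, h3]
      calc (f x - lowPart d f x) ^ 2 = |f x - lowPart d f x| ^ 2 := (sq_abs _).symm
        _ ≤ (3 * y) ^ 2 := pow_le_pow_left₀ (abs_nonneg _) h2 2
        _ = 9 * y ^ 2 := by ring
        _ ≤ 9 * y ^ 512 := by
          have := pow_le_pow_right₀ hy1 (show 2 ≤ 512 by norm_num)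
          linarith
    · have h1 : truncTail d τ f x = 0 := by simp [truncTail, h]
      have h2 : 0 ≤ lowPart d f x ^ 512 := Even.pow_nonneg ⟨256, rfl⟩ _
      rw [h1, sq, mul_zero]
      positivity
  have hint := integral_mono (memLp_two_truncTail d τ hf).integrable_sq
    (integrable_mvPolynomial_eval Q) hpt
  rw [← gaussExp_apply, hQ, map_smul, smul_eq_mul] at hint
  have hyp := gaussExp_pow_two_pow_le hd _ (totalDegree_lowPoly_le d f) 8
  rw [gaussExp_lowPoly_sq] at hyp
  calc ∫ x, truncTail d τ f x ^ 2 ∂(stdGauss k)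
      ≤ 9 * (τ ^ 512)⁻¹ * gaussExp k (lowPoly d f ^ 512) := hint
    _ ≤ 9 * (τ ^ 512)⁻¹ * (9 ^ (8 * d) * hermiteWeight d f) ^ 256 := by
        gcongr
        simpa using hyp
    _ = 9 * (9 ^ (8 * d) * hermiteWeight d f / τ ^ 2) ^ 256 := by
        rw [div_pow, ← pow_mul]; ring

/-! ### Convergence of the iteration -/

lemma eLpNorm_two_eq_ofReal_sqrt {k : ℕ} {g : (Fin k → ℝ) → ℝ} (hg : MemLp g 2 (stdGauss k)) :
    eLpNorm g 2 (stdGauss k) = ENNReal.ofReal √(∫ x, g x ^ 2 ∂(stdGauss k)) := by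
  rw [hg.eLpNorm_eq_integral_rpow_norm two_ne_zero ENNReal.ofNat_ne_top, Real.sqrt_eq_rpow]
  simp

lemma hermiteWeight_le_eLpNorm_sq {k : ℕ} (d : ℕ) {g : (Fin k → ℝ) → ℝ}
    (hg : MemLp g 2 (stdGauss k)) :
    hermiteWeight d g ≤ (eLpNorm g 2 (stdGauss k)).toReal ^ 2 := by
  rw [eLpNorm_two_eq_ofReal_sqrt hg, ENNReal.toReal_ofReal (Real.sqrt_nonneg _),
    Real.sq_sqrt (integral_nonneg fun x => sq_nonneg _)]
  exact hermiteWeight_le_integral_sq d hg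

lemma memLp_two_of_abs_eq_one {k : ℕ} {f : (Fin k → ℝ) → ℝ} (hfm : AEMeasurable f (stdGauss k))
    (hf : ∀ x, |f x| = 1) : MemLp f 2 (stdGauss k) :=
  MemLp.of_bound hfm.aestronglyMeasurable 1 (ae_of_all _ fun x => (hf x).le)

/-- The invariants of the iteration with thresholds `τ_i = (α / 8) 2⁻ⁱ`: the sup norms stay below
`1 + α / 4` and the low-degree weight decays like `16⁻ⁱ`. -/
lemma truncIter_invariant {k d : ℕ} (hd : 1 ≤ d) {f : (Fin k → ℝ) → ℝ}
    (hfm : AEMeasurable f (stdGauss k)) (hf : ∀ x, |f x| = 1) {α : ℝ} (hα0 : 0 < α) (hα1 : α ≤ 1)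
    (hkey : 9 * (9 ^ (8 * d) * (64 * hermiteWeight d f) / α ^ 2) ^ 256 ≤ hermiteWeight d f / 16)
    (i : ℕ) :
    MemLp (truncIter d (fun i => α / 8 * (1 / 2) ^ i) f i) 2 (stdGauss k) ∧
    (∀ x, |truncIter d (fun i => α / 8 * (1 / 2) ^ i) f i x| ≤ 1 + α / 4 * (1 - (1 / 2) ^ i)) ∧
    hermiteWeight d (truncIter d (fun i => α / 8 * (1 / 2) ^ i) f i)
      ≤ hermiteWeight d f * (1 / 16) ^ i ∧
    ∫ x, truncTail d (α / 8 * (1 / 2) ^ i) (truncIter d (fun i => α / 8 * (1 / 2) ^ i) f i) x ^ 2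
        ∂(stdGauss k) ≤ hermiteWeight d f * (1 / 16) ^ (i + 1) := by
  have htail : ∀ (i : ℕ) (g : (Fin k → ℝ) → ℝ), MemLp g 2 (stdGauss k) →
      (∀ x, |g x| ≤ 1 + α / 4 * (1 - (1 / 2) ^ i)) →
      hermiteWeight d g ≤ hermiteWeight d f * (1 / 16) ^ i →
      ∫ x, truncTail d (α / 8 * (1 / 2) ^ i) g x ^ 2 ∂(stdGauss k)
        ≤ hermiteWeight d f * (1 / 16) ^ (i + 1) := by
    intro i g hg hgb hgw
    have hw0 := hermiteWeight_nonneg d g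
    have hγ0 := hermiteWeight_nonneg d f
    have hi0 : (0 : ℝ) < (1 / 2) ^ i := by positivity
    have hi1 : ((1 : ℝ) / 2) ^ i ≤ 1 := pow_le_one₀ (by norm_num) (by norm_num)
    refine (integral_truncTail_sq_le hd (by positivity) (by nlinarith) hg fun x =>
      (hgb x).trans (by nlinarith)).trans ?_
    have h16 : ((1 : ℝ) / 16) ^ i = ((1 / 2) ^ i) ^ 4 := by
      rw [← pow_mul, mul_comm, pow_mul]; norm_num
    have h1 : 9 ^ (8 * d) * hermiteWeight d g / (α / 8 * (1 / 2) ^ i) ^ 2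
        ≤ 9 ^ (8 * d) * (64 * hermiteWeight d f) / α ^ 2 * ((1 / 2) ^ i) ^ 2 := by
      rw [h16] at hgw
      calc 9 ^ (8 * d) * hermiteWeight d g / (α / 8 * (1 / 2) ^ i) ^ 2
          ≤ 9 ^ (8 * d) * (hermiteWeight d f * ((1 / 2) ^ i) ^ 4) / (α / 8 * (1 / 2) ^ i) ^ 2 := by
            gcongr
        _ = _ := by field_simp; ring
    calc 9 * (9 ^ (8 * d) * hermiteWeight d g / (α / 8 * (1 / 2) ^ i) ^ 2) ^ 256
        ≤ 9 * (9 ^ (8 * d) * (64 * hermiteWeight d f) / α ^ 2 * ((1 / 2) ^ i) ^ 2) ^ 256 := by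
          gcongr
      _ = 9 * (9 ^ (8 * d) * (64 * hermiteWeight d f) / α ^ 2) ^ 256 * ((1 / 2) ^ i) ^ 512 := by
          rw [mul_pow, ← pow_mul, mul_assoc]
      _ ≤ hermiteWeight d f / 16 * ((1 / 2) ^ i) ^ 4 := by
          refine mul_le_mul hkey ?_ (by positivity) (by positivity)
          exact pow_le_pow_of_le_one hi0.le hi1 (by norm_num)
      _ = hermiteWeight d f * (1 / 16) ^ (i + 1) := by rw [pow_succ (1 / 16 : ℝ), h16]; ring
  induction i with
  | zero =>
    have h1 : MemLp (truncIter d (fun i => α / 8 * (1 / 2) ^ i) f 0) 2 (stdGauss k) :=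
      memLp_two_of_abs_eq_one hfm hf
    have h2 : ∀ x, |truncIter d (fun i => α / 8 * (1 / 2) ^ i) f 0 x|
        ≤ 1 + α / 4 * (1 - (1 / 2) ^ 0) := fun x => by simp [truncIter, hf]
    have h3 : hermiteWeight d (truncIter d (fun i => α / 8 * (1 / 2) ^ i) f 0)
        ≤ hermiteWeight d f * (1 / 16) ^ 0 := by simp [truncIter]
    exact ⟨h1, h2, h3, htail 0 _ h1 h2 h3⟩
  | succ i ih =>
    obtain ⟨h1, h2, h3, h4⟩ := ih
    have h1' := memLp_two_truncHigh d (α / 8 * (1 / 2) ^ i) h1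
    have h2' : ∀ x, |truncIter d (fun i => α / 8 * (1 / 2) ^ i) f (i + 1) x|
        ≤ 1 + α / 4 * (1 - (1 / 2) ^ (i + 1)) := fun x => by
      refine (abs_truncHigh_le d (by positivity) _ x).trans ?_
      have := h2 x
      rw [pow_succ]
      linarith
    have h3' := (hermiteWeight_truncHigh_le d (α / 8 * (1 / 2) ^ i) h1).trans h4
    exact ⟨h1', h2', h3', htail (i + 1) _ h1' h2' h3'⟩

/-- The iteration converges in `L²` to a bounded function without low-degree part, close to `f`. -/
lemma exists_limit_truncIter {k d : ℕ} (hd : 1 ≤ d) {f : (Fin k → ℝ) → ℝ}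
    (hfm : AEMeasurable f (stdGauss k)) (hf : ∀ x, |f x| = 1) {α : ℝ} (hα0 : 0 < α) (hα1 : α ≤ 1)
    (hkey : 9 * (9 ^ (8 * d) * (64 * hermiteWeight d f) / α ^ 2) ^ 256 ≤ hermiteWeight d f / 16)
    (h16 : 16 * hermiteWeight d f ≤ α ^ 2) :
    ∃ τ : ℕ → ℝ, (∀ i, 0 < τ i) ∧ ∃ fstar : (Fin k → ℝ) → ℝ, MemLp fstar 2 (stdGauss k) ∧
      (∀ i, MemLp (truncIter d τ f i) 2 (stdGauss k)) ∧
      Tendsto (fun i => eLpNorm (truncIter d τ f i - fstar) 2 (stdGauss k)) atTop (𝓝 0) ∧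
      (∀ᵐ x ∂(stdGauss k), |fstar x| ≤ 1 + α / 4) ∧
      (∀ J ∈ lowIndices k d, hermiteCoeff fstar J = 0) ∧
      eLpNorm (f - fstar) 2 (stdGauss k) ≤ ENNReal.ofReal (3 / 4 * α) := by
  set γ := hermiteWeight d f with hγ
  have hγ0 : 0 ≤ γ := hermiteWeight_nonneg d f
  have hinv := truncIter_invariant hd hfm hf hα0 hα1 hkey
  set τ : ℕ → ℝ := fun i => α / 8 * (1 / 2) ^ i with hτ
  set F : ℕ → (Fin k → ℝ) → ℝ := truncIter d τ f with hF
  have hmem : ∀ i, MemLp (F i) 2 (stdGauss k) := fun i => (hinv i).1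
  have hfact : Fact ((1 : ℝ≥0∞) ≤ 2) := ⟨by norm_num⟩
  set u : ℕ → Lp ℝ 2 (stdGauss k) := fun i => (hmem i).toLp (F i) with hu
  have hdist : ∀ i, dist (u i) (u (i + 1)) ≤ 2 * √γ * (1 / 4) ^ i := by
    intro i
    have h1 : ∫ x, (F i x - F (i + 1) x) ^ 2 ∂(stdGauss k) ≤ (2 * √γ * (1 / 4) ^ i) ^ 2 := by
      refine (integral_sub_truncHigh_sq_le d (τ i) (hmem i)).trans ?_
      have h3 := (hinv i).2.2.1
      have h4 := (hinv i).2.2.2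
      have h5 : ((1 : ℝ) / 16) ^ i = ((1 / 4) ^ i) ^ 2 := by
        rw [← pow_mul, mul_comm, pow_mul]; norm_num
      rw [mul_pow, mul_pow, Real.sq_sqrt hγ0, ← h5]
      rw [pow_succ] at h4
      have h6 : 0 ≤ γ * (1 / 16) ^ i := by positivity
      linarith
    rw [dist_edist, Lp.edist_toLp_toLp, eLpNorm_two_eq_ofReal_sqrt ((hmem i).sub (hmem (i + 1))),
      ENNReal.toReal_ofReal (Real.sqrt_nonneg _)]
    exact Real.sqrt_le_iff.mpr ⟨by positivity, h1⟩
  obtain ⟨ulim, hulim⟩ := cauchySeq_tendsto_of_complete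
    (cauchySeq_of_le_geometric _ _ (by norm_num) hdist)
  obtain ⟨v, hstar, rfl⟩ : ∃ (v : (Fin k → ℝ) → ℝ) (h : MemLp v 2 (stdGauss k)),
      h.toLp v = ulim := ⟨ulim, Lp.memLp ulim, Lp.toLp_coeFn _ _⟩
  have hlim : Tendsto (fun i => eLpNorm (F i - v) 2 (stdGauss k)) atTop (𝓝 0) :=
    (Lp.tendsto_Lp_iff_tendsto_eLpNorm'' F hmem v hstar).mp hulim
  refine ⟨τ, fun i => by positivity, v, hstar, hmem, hlim, ?_, ?_, ?_⟩
  · obtain ⟨ns, -, hns⟩ := (tendstoInMeasure_of_tendsto_eLpNorm two_ne_zero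
      (fun i => (hmem i).aestronglyMeasurable) hstar.aestronglyMeasurable
      hlim).exists_seq_tendsto_ae
    filter_upwards [hns] with x hx
    refine le_of_tendsto hx.abs (Eventually.of_forall fun i => ((hinv (ns i)).2.1 x).trans ?_)
    have : (0 : ℝ) < (1 / 2) ^ (ns i) := by positivity
    nlinarith
  · rw [← hermiteWeight_eq_zero_iff]
    refine le_antisymm ?_ (hermiteWeight_nonneg _ _)
    have hb : ∀ i, hermiteWeight d v
        ≤ 2 * (eLpNorm (F i - v) 2 (stdGauss k)).toReal ^ 2 + 2 * (γ * (1 / 16) ^ i) := by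
      intro i
      have h1 := hermiteWeight_sub_le (d := d) hstar (hmem i)
      have h2 := hermiteWeight_le_eLpNorm_sq d (hstar.sub (hmem i))
      rw [eLpNorm_sub_comm] at h2
      have h3 := (hinv i).2.2.1
      exact h1.trans (add_le_add (mul_le_mul_of_nonneg_left h2 zero_le_two)
        (mul_le_mul_of_nonneg_left h3 zero_le_two))
    refine ge_of_tendsto' (f := fun i => 2 * (eLpNorm (F i - v) 2 (stdGauss k)).toReal ^ 2
      + 2 * (γ * (1 / 16) ^ i)) (x := atTop) ?_ hb
    have h1 := (ENNReal.tendsto_toReal ENNReal.zero_ne_top).comp hlim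
    have h2 := tendsto_pow_atTop_nhds_zero_of_lt_one (r := (1 : ℝ) / 16) (by norm_num) (by norm_num)
    have := ((h1.pow 2).const_mul 2).add ((h2.const_mul γ).const_mul 2)
    simpa using this
  · have h1 := dist_le_of_le_geometric_of_tendsto₀ _ _ (by norm_num) hdist hulim
    have h2 : edist (u 0) (hstar.toLp v) = eLpNorm (f - v) 2 (stdGauss k) :=
      Lp.edist_toLp_toLp (F 0) v (hmem 0) hstar
    rw [← h2, edist_dist]
    refine ENNReal.ofReal_le_ofReal (h1.trans ?_)
    have h3 : 4 * √γ ≤ α := by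
      refine abs_le_of_sq_le_sq' ?_ hα0.le |>.2
      rw [mul_pow, Real.sq_sqrt hγ0]
      linarith
    rw [show 2 * √γ / (1 - 1 / 4) = 8 / 3 * √γ by ring]
    linarith

/-- A bounded function without low-degree part becomes resilient after rescaling it to sup norm at
most `1` and correcting it on a null set. -/
lemma exists_witness {k d : ℕ} {f fstar : (Fin k → ℝ) → ℝ} {α β δ : ℝ}
    (hfm : MemLp f 2 (stdGauss k)) (hs2 : MemLp fstar 2 (stdGauss k))
    (hβ : 0 ≤ β) (hb : ∀ᵐ x ∂(stdGauss k), |fstar x| ≤ 1 + β)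
    (hc : ∀ J ∈ lowIndices k d, hermiteCoeff fstar J = 0) (hδ : 0 ≤ δ)
    (hd : eLpNorm (f - fstar) 2 (stdGauss k) ≤ ENNReal.ofReal δ) (hα : δ + β ≤ α) :
    MemLp fstar ∞ (stdGauss k) ∧ ∃ g : (Fin k → ℝ) → ℝ, IsResilienceWitness d α f g ∧
      g =ᵐ[stdGauss k] fun x => fstar x / max 1 (eLpNorm fstar ∞ (stdGauss k)).toReal := by
  have hinf : MemLp fstar ∞ (stdGauss k) := memLp_top_of_bound hs2.aestronglyMeasurable (1 + β) hb
  set M : ℝ := max 1 (eLpNorm fstar ∞ (stdGauss k)).toReal with hM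
  have hM1 : 1 ≤ M := le_max_left _ _
  have hM0 : 0 < M := by linarith
  have hMβ : M ≤ 1 + β := by
    refine max_le (by linarith) (ENNReal.toReal_le_of_le_ofReal (by linarith) ?_)
    rw [eLpNorm_exponent_top]
    exact eLpNormEssSup_le_of_ae_bound hb
  have hbM : ∀ᵐ x ∂(stdGauss k), |fstar x| ≤ M := by
    filter_upwards [ae_le_eLpNormEssSup (f := fstar) (μ := stdGauss k)] with x hx
    rw [← eLpNorm_exponent_top] at hx
    have := ENNReal.toReal_mono hinf.eLpNorm_lt_top.ne hx
    rw [toReal_enorm, Real.norm_eq_abs] at this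
    exact this.trans (le_max_right _ _)
  set h := hs2.aestronglyMeasurable.mk fstar with hh
  have hmeas : Measurable h := hs2.aestronglyMeasurable.stronglyMeasurable_mk.measurable
  have hae : fstar =ᵐ[stdGauss k] h := hs2.aestronglyMeasurable.ae_eq_mk
  set g : (Fin k → ℝ) → ℝ := fun x => max (-1) (min 1 (h x / M)) with hg
  have hgae : g =ᵐ[stdGauss k] fun x => fstar x / M := by
    filter_upwards [hae, hbM] with x hx hxM
    have h1 : |fstar x / M| ≤ 1 := by
      rw [abs_div, abs_of_pos hM0]; exact (div_le_one hM0).mpr hxM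
    rw [abs_le] at h1
    simp only [hg, ← hx]
    rw [min_eq_right h1.2, max_eq_right h1.1]
  refine ⟨hinf, g, ⟨⟨?_, fun x => ⟨le_max_left _ _, max_le (by norm_num) (min_le_left _ _)⟩, ?_⟩,
    ?_⟩, hgae⟩
  · exact measurable_const.max (measurable_const.min (hmeas.div_const M))
  · intro p hp
    have h1 : ∫ x, g x * MvPolynomial.eval x p ∂(stdGauss k)
        = ∫ x, M⁻¹ * (fstar x * MvPolynomial.eval x p) ∂(stdGauss k) := by
      refine integral_congr_ae ?_
      filter_upwards [hgae] with x hx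
      rw [hx]; ring
    rw [h1, integral_const_mul, integral_mul_eval_eq_zero hs2 hc p hp, mul_zero]
  · have hgm : AEStronglyMeasurable (fun x => fstar x / M) (stdGauss k) :=
      (hs2.aestronglyMeasurable.aemeasurable.div_const M).aestronglyMeasurable
    have h1 : eLpNorm (f - fstar) 1 (stdGauss k) ≤ ENNReal.ofReal δ :=
      (eLpNorm_le_eLpNorm_of_exponent_le (by norm_num)
        (hfm.sub hs2).aestronglyMeasurable).trans hd
    have h2 : eLpNorm (fstar - fun x => fstar x / M) 1 (stdGauss k) ≤ ENNReal.ofReal β := by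
      refine (eLpNorm_le_of_ae_bound (C := β) ?_).trans (by simp)
      filter_upwards [hbM] with x hx
      have h3 : fstar x - fstar x / M = fstar x / M * (M - 1) := by field_simp
      have h4 : |fstar x| / M ≤ 1 := (div_le_one hM0).mpr hx
      rw [Pi.sub_apply, h3, Real.norm_eq_abs, abs_mul, abs_div, abs_of_pos hM0,
        abs_of_nonneg (by linarith : (0 : ℝ) ≤ M - 1)]
      nlinarith
    calc eLpNorm (f - g) 1 (stdGauss k)
        = eLpNorm ((f - fstar) + (fstar - fun x => fstar x / M)) 1 (stdGauss k) := by
          refine eLpNorm_congr_ae ?_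
          filter_upwards [hgae] with x hx
          simp [hx]
      _ ≤ eLpNorm (f - fstar) 1 (stdGauss k)
          + eLpNorm (fstar - fun x => fstar x / M) 1 (stdGauss k) :=
        eLpNorm_add_le (hfm.sub hs2).aestronglyMeasurable
          (hs2.aestronglyMeasurable.sub hgm) le_rfl
      _ ≤ ENNReal.ofReal δ + ENNReal.ofReal β := add_le_add h1 h2
      _ ≤ ENNReal.ofReal α := by
        rw [← ENNReal.ofReal_add hδ hβ]; exact ENNReal.ofReal_le_ofReal hα

/-! ### The choice of parameters -/

/-- The exponent `0.498 < 1/2` leaves the factor `γ ^ 0.004` in `γ / α²`; its 256th power supplies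
the missing factor `γ` in the bound for the next low-degree weight, while a large `R` absorbs all
absolute constants. -/
lemma parameter_bounds {d : ℕ} (hd : 1 ≤ d) {γ R α : ℝ} (hγ : 0 < γ) (hR : 128 * 9 ^ 8 ≤ R)
    (hα : α = γ ^ (0.498 : ℝ) * R ^ ((d : ℝ) / 2)) (hα1 : α < 1) :
    0 < α ∧ 16 * γ ≤ α ^ 2 ∧ 9 * (9 ^ (8 * d) * (64 * γ) / α ^ 2) ^ 256 ≤ γ / 16 := by
  have hR1 : 1 ≤ R := le_trans (by norm_num) hR
  have hR0 : 0 < R := by linarith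
  have hα0 : 0 < α := by rw [hα]; positivity
  have hRd : 128 * 9 ^ (8 * d) ≤ R ^ d := by
    calc (128 : ℝ) * 9 ^ (8 * d) ≤ 128 ^ d * 9 ^ (8 * d) := by
          gcongr
          exact le_self_pow₀ (by norm_num) (by omega)
      _ = (128 * 9 ^ 8) ^ d := by rw [mul_pow, pow_mul]
      _ ≤ R ^ d := pow_le_pow_left₀ (by positivity) hR d
  have hα2 : α ^ 2 = γ ^ (0.996 : ℝ) * R ^ d := by
    rw [hα, mul_pow, ← Real.rpow_natCast (γ ^ _), ← Real.rpow_mul hγ.le,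
      ← Real.rpow_natCast (R ^ _), ← Real.rpow_mul hR0.le, ← Real.rpow_natCast R d]
    congr 2 <;> norm_num
  have hγ1 : γ ≤ 1 := by
    by_contra hlt
    push Not at hlt
    have h1 : 1 ≤ γ ^ (0.498 : ℝ) := Real.one_le_rpow hlt.le (by norm_num)
    have h2 : 1 ≤ R ^ ((d : ℝ) / 2) := Real.one_le_rpow hR1 (by positivity)
    have h3 : 1 ≤ α := hα ▸ one_le_mul_of_one_le_of_one_le h1 h2
    linarith
  have hsplit : γ = γ ^ (0.996 : ℝ) * γ ^ (0.004 : ℝ) := by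
    rw [← Real.rpow_add hγ]; norm_num
  have h996 : 0 < γ ^ (0.996 : ℝ) := by positivity
  have h004 : 0 < γ ^ (0.004 : ℝ) := by positivity
  refine ⟨hα0, ?_, ?_⟩
  · have h9 : (1 : ℝ) ≤ 9 ^ (8 * d) := one_le_pow₀ (by norm_num)
    have hγle : γ ≤ γ ^ (0.996 : ℝ) := by
      conv_lhs => rw [← Real.rpow_one γ]
      exact Real.rpow_le_rpow_of_exponent_ge hγ hγ1 (by norm_num)
    rw [hα2]
    calc 16 * γ ≤ R ^ d * γ ^ (0.996 : ℝ) := by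
          refine mul_le_mul (by linarith) hγle hγ.le (by positivity)
      _ = _ := mul_comm _ _
  · have hX : 9 ^ (8 * d) * (64 * γ) / α ^ 2 ≤ 1 / 2 * γ ^ (0.004 : ℝ) := by
      rw [div_le_iff₀ (by positivity), hα2]
      calc 9 ^ (8 * d) * (64 * γ)
          = 1 / 2 * (128 * 9 ^ (8 * d)) * (γ ^ (0.996 : ℝ) * γ ^ (0.004 : ℝ)) := by
            rw [← hsplit]; ring
        _ ≤ 1 / 2 * R ^ d * (γ ^ (0.996 : ℝ) * γ ^ (0.004 : ℝ)) := by gcongr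
        _ = _ := by ring
    have hpow : (γ ^ (0.004 : ℝ)) ^ 256 ≤ γ := by
      rw [← Real.rpow_natCast, ← Real.rpow_mul hγ.le]
      conv_rhs => rw [← Real.rpow_one γ]
      exact Real.rpow_le_rpow_of_exponent_ge hγ hγ1 (by norm_num)
    calc 9 * (9 ^ (8 * d) * (64 * γ) / α ^ 2) ^ 256
        ≤ 9 * (1 / 2 * γ ^ (0.004 : ℝ)) ^ 256 := by gcongr
      _ = 9 * (1 / 2) ^ 256 * (γ ^ (0.004 : ℝ)) ^ 256 := by rw [mul_pow, mul_assoc]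
      _ ≤ 1 / 16 * γ := by
          refine mul_le_mul (by norm_num) hpow (by positivity) (by norm_num)
      _ = γ / 16 := by ring

lemma truncIter_eq_self {k d : ℕ} {f : (Fin k → ℝ) → ℝ} (h : hermiteWeight d f = 0) (i : ℕ) :
    truncIter d (fun _ => 1) f i = f := by
  have h0 : ∀ x, lowPart d f x = 0 := fun x =>
    Finset.sum_eq_zero fun J hJ => by rw [hermiteWeight_eq_zero_iff.mp h J hJ, zero_mul]
  induction i with
  | zero => rfl
  | succ i ih =>
    ext x
    simp [truncIter, ih, truncHigh, highPart, h0]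

theorem mainTheorem5 :
    ∃ k₀ : ℕ, ∀ k : ℕ, k₀ ≤ k → ∀ d : ℕ, 2 ≤ d →
      ∀ f : (Fin k → ℝ) → ℝ, AEMeasurable f (stdGauss k) → (∀ x, f x = 1 ∨ f x = -1) →
      ∀ γ α : ℝ, γ = hermiteWeight d f →
        α = γ ^ (0.498 : ℝ) * (72 * Real.log k) ^ ((d : ℝ) / 2) →
        IsApproxResilient d α f ∧
        (α < 1 → ∃ τ : ℕ → ℝ, (∀ i, 0 < τ i) ∧
          ∃ fstar : (Fin k → ℝ) → ℝ,
            MemLp fstar 2 (stdGauss k) ∧ MemLp fstar ∞ (stdGauss k) ∧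
            (∀ i, MemLp (truncIter d τ f i) 2 (stdGauss k)) ∧
            Tendsto (fun i => eLpNorm (truncIter d τ f i - fstar) 2 (stdGauss k)) atTop (𝓝 0) ∧
            ∃ g : (Fin k → ℝ) → ℝ, IsResilienceWitness d α f g ∧
              g =ᵐ[stdGauss k]
                fun x => fstar x / max 1 (eLpNorm fstar ∞ (stdGauss k)).toReal) := by
  -- `k₀` is chosen so that `72 ln k` exceeds the constant needed in `parameter_bounds`
  refine ⟨⌈Real.exp (128 * 9 ^ 8)⌉₊, fun k hk d hd f hfm hf γ α hγ hα => ?_⟩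
  have hR : 128 * 9 ^ 8 ≤ 72 * Real.log k := by
    have h1 : (128 * 9 ^ 8 : ℝ) ≤ Real.log k := by
      rw [← Real.log_exp (128 * 9 ^ 8)]
      exact Real.log_le_log (Real.exp_pos _) (Nat.ceil_le.mp hk)
    linarith
  have hR0 : (0 : ℝ) ≤ 72 * Real.log k := le_trans (by positivity) hR
  have hf1 : ∀ x, |f x| = 1 := fun x => by rcases hf x with h | h <;> simp [h]
  have hf2 := memLp_two_of_abs_eq_one hfm hf1
  have hγ0 : 0 ≤ γ := hγ ▸ hermiteWeight_nonneg d f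
  have hα0 : 0 ≤ α := by rw [hα]; positivity
  have hmain : α < 1 → ∃ τ : ℕ → ℝ, (∀ i, 0 < τ i) ∧ ∃ fstar : (Fin k → ℝ) → ℝ,
      MemLp fstar 2 (stdGauss k) ∧ MemLp fstar ∞ (stdGauss k) ∧
      (∀ i, MemLp (truncIter d τ f i) 2 (stdGauss k)) ∧
      Tendsto (fun i => eLpNorm (truncIter d τ f i - fstar) 2 (stdGauss k)) atTop (𝓝 0) ∧
      ∃ g : (Fin k → ℝ) → ℝ, IsResilienceWitness d α f g ∧
        g =ᵐ[stdGauss k] fun x => fstar x / max 1 (eLpNorm fstar ∞ (stdGauss k)).toReal := by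
    intro hα1
    rcases hγ0.eq_or_lt with h0 | hpos
    · -- without low-degree weight the iteration is constant, whatever the thresholds are
      have hw : hermiteWeight d f = 0 := by rw [← hγ, ← h0]
      obtain ⟨hinf, g, hg⟩ := exists_witness (α := α) (β := 0) (δ := 0) hf2 hf2 le_rfl
        (ae_of_all _ fun x => by simp [hf1]) (hermiteWeight_eq_zero_iff.mp hw) le_rfl
        (by simp) (by simpa using hα0)
      refine ⟨fun _ => 1, fun _ => one_pos, f, hf2, hinf, fun i => ?_, ?_, g, hg⟩
      · rwa [truncIter_eq_self hw]
      · simp [truncIter_eq_self hw]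
    · obtain ⟨hαpos, h16, hkey⟩ := parameter_bounds (by omega) hpos hR hα hα1
      rw [hγ] at h16 hkey
      obtain ⟨τ, hτ, fstar, hs2, hmem, hlim, hb, hc, hdist⟩ :=
        exists_limit_truncIter (by omega) hfm hf1 hαpos hα1.le hkey h16
      obtain ⟨hinf, g, hg⟩ := exists_witness (α := α) (β := α / 4) hf2 hs2 (by positivity) hb hc
        (by positivity) hdist (by linarith)
      exact ⟨τ, hτ, fstar, hs2, hinf, hmem, hlim, g, hg⟩
  refine ⟨⟨hα0, ?_⟩, hmain⟩
  rcases lt_or_ge α 1 with hα1 | hα1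
  · obtain ⟨_, _, _, _, _, _, _, g, hg, _⟩ := hmain hα1
    exact ⟨g, hg⟩
  · -- for `α ≥ 1` the zero function is a witness
    refine ⟨0, ⟨measurable_const, fun x => by simp, fun p _ => by simp⟩, ?_⟩
    rw [sub_zero]
    refine (eLpNorm_le_of_ae_bound (C := 1) (ae_of_all _ fun x => (hf1 x).le)).trans ?_
    simpa using hα1
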